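/- **Setting.** Let $N$ players have compact convex action sets $\mathcal X_i\subset\mathbb R^{n_i}$ ($n_i\ge 1$) with nonempty interior; put $\mathcal X=\prod_i\mathcal X_i$, $n=\sum_i n_i$, and let $\|\cdot\|$ be the Euclidean norm. The payoffs $u_i:\mathcal X\to\mathbb R$ are continuous, $u_i(x_i;x_{-i})$ is concave and continuously differentiable in $x_i$, and $v_i(x)=\nabla_i u_i(x)$ is Lipschitz on $\mathcal X$. For some $\beta>0$ and weights $\lambda_i>0$ the game is $\beta$-strongly monotone: $\sum_i\lambda_i\langle x_i'-x_i,\,v_i(x')-v_i(x)\rangle\le-\beta\|x-x'\|^2$ for all $x,x'\in\mathcal X$. Moreover $|u_i(x)|\le L$ for all $i$ and $x\in\mathcal X$. For each $i$ let $R_i:\operatorname{int}(\mathcal X_i)\to\mathbb R$ be a $\nu_i$-self-concordant barrier: $R_i$ is convex and $C^3$, $R_i(x)\to\infty$ as $x\to\partial\mathcal X_i$, and for all $x\in\operatorname{int}(\mathcal X_i)$, $h\in\mathbb R^{n_i}$, $$|\nabla^3R_i(x)[h,h,h]|\le 2\,(h^\top\nabla^2R_i(x)h)^{3/2},\qquad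 |\nabla R_i(x)^\top h|\le\sqrt{\nu_i}\,(h^\top\nabla^2R_i(x)h)^{1/2}.$$ Write $D_{R_i}(x',x)=R_i(x')-R_i(x)-\langle\nabla R_i(x),x'-x\rangle$. **Algorithm (exact bandit feedback).** Put $\eta_t=\frac1{2nL\sqrt t}$ and $x_i^1=\operatorname{argmin}_{\operatorname{int}(\mathcal X_i)}R_i$. In round $t=1,2,\dots$ every player $i$ sets $A_i^t=\big(\nabla^2R_i(x_i^t)+\tfrac{\eta_t\beta(t+1)}{\lambda_i}I\big)^{-1/2}$, draws $z_i^t$ uniformly from the unit sphere of $\mathbb R^{n_i}$ (independently over $i$ and $t$), plays $\hat x_i^t=x_i^t+A_i^tz_i^t$, receives $u_i(\hat x^t)$, sets $\hat v_i^t=n_i\,u_i(\hat x^t)\,(A_i^t)^{-1}z_i^t$, and updates $$x_i^{t+1}=\operatorname*{argmin}_{x'\in\operatorname{int}(\mathcal X_i)}\ \eta_t\langle\hat v_i^t,x_i^t-x'\rangle+\tfrac{\eta_t\beta(t+1)}{2\lambda_i}\|x_i^t-x'\|^2+D_{R_i}(x',x_i^t).$$ **Theorem.** Let $x^\star\in\mathcal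 X$ be a (pure) Nash equilibrium, i.e. $u_i(x_i;x^\star_{-i})\le u_i(x^\star)$ for all $i$ and $x_i\in\mathcal X_i$. Then $x^\star$ is the only Nash equilibrium, and $$\mathbb E\Big[\sum_{i=1}^N\|\hat x_i^T-x_i^\star\|^2\Big]=\tilde O\Big(\frac1{\sqrt T}\Big),$$ that is, there are constants $C$ and $k\in\mathbb N$, not depending on $T$, such that the left-hand side is at most $C(\log T)^k/\sqrt T$ for all $T\ge2$. -/

import Mathlib

open MeasureTheory ProbabilityTheory

noncomputable section

namespace BanditGame

/-- `ℝⁿ` with its Euclidean norm and inner product. -/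
abbrev E (n : ℕ) : Type := EuclideanSpace ℝ (Fin n)

/-- Joint actions `x = (x_1, …, x_N)`, with `x_i ∈ ℝ^{d i}`. -/
abbrev Profile {N : ℕ} (d : Fin N → ℕ) : Type := (i : Fin N) → E (d i)

/-- The squared Euclidean distance `∑ i, ‖x_i - y_i‖²` of two joint actions. -/
def sqDist {N : ℕ} {d : Fin N → ℕ} (x y : Profile d) : ℝ := ∑ i, ‖x i - y i‖ ^ 2

/-- The individual payoff gradient `v_i(x) = ∇_i u_i(x_i; x_{-i})`, the derivative being taken
within the action set `X i` (so that it makes sense at boundary points too). -/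
def payoffGrad {N : ℕ} {d : Fin N → ℕ} (X : (i : Fin N) → Set (E (d i)))
    (u : Fin N → Profile d → ℝ) (i : Fin N) (x : Profile d) : E (d i) :=
  gradientWithin (fun y => u i (Function.update x i y)) (X i) (x i)

/-- A smooth concave game with `N` players; the payoffs matter only on the product of the
action sets. -/
structure SmoothConcaveGame (N : ℕ) (d : Fin N → ℕ) where
  /-- action sets -/
  X : (i : Fin N) → Set (E (d i))
  /-- payoff functions -/
  u : Fin N → Profile d → ℝ
  convex_X : ∀ i, Convex ℝ (X i)
  compact_X : ∀ i, IsCompact (X i)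
  continuousOn_u : ∀ i, ContinuousOn (u i) (Set.univ.pi X)
  concaveOn_u : ∀ i, ∀ x ∈ Set.univ.pi X,
    ConcaveOn ℝ (X i) (fun y => u i (Function.update x i y))
  differentiableOn_u : ∀ i, ∀ x ∈ Set.univ.pi X,
    DifferentiableOn ℝ (fun y => u i (Function.update x i y)) (X i)
  lipschitz_grad : ∀ i, ∃ ℓ : ℝ, ∀ x ∈ Set.univ.pi X, ∀ x' ∈ Set.univ.pi X,
    ‖payoffGrad X u i x - payoffGrad X u i x'‖ ≤ ℓ * √(sqDist x x')

namespace SmoothConcaveGame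

variable {N : ℕ} {d : Fin N → ℕ}

/-- The set of joint actions. -/
def actions (G : SmoothConcaveGame N d) : Set (Profile d) := Set.univ.pi G.X

/-- The individual payoff gradient of player `i`. -/
def v (G : SmoothConcaveGame N d) (i : Fin N) (x : Profile d) : E (d i) :=
  payoffGrad G.X G.u i x

/-- Pure-strategy Nash equilibria. -/
def IsNash (G : SmoothConcaveGame N d) (x : Profile d) : Prop :=
  x ∈ G.actions ∧ ∀ i, ∀ y ∈ G.X i, G.u i (Function.update x i y) ≤ G.u i x

/-- The game is `β`-strongly monotone, with weights `lam i`. -/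
def IsStronglyMonotone (G : SmoothConcaveGame N d) (lam : Fin N → ℝ) (β : ℝ) : Prop :=
  0 < β ∧ (∀ i, 0 < lam i) ∧ ∀ x ∈ G.actions, ∀ x' ∈ G.actions,
    ∑ i, lam i * inner ℝ (x' i - x i) (G.v i x' - G.v i x) ≤ -β * sqDist x x'

end SmoothConcaveGame

/-- `R` (of which only the restriction to `interior X` matters) is a `ν`-self-concordant barrier
for `X`. -/
structure IsSelfConcordantBarrier {n : ℕ} (X : Set (E n)) (ν : ℝ) (R : E n → ℝ) : Prop where
  contDiffOn : ContDiffOn ℝ 3 R (interior X)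
  convexOn : ConvexOn ℝ (interior X) R
  tendsto_atTop : ∀ b ∈ frontier X,
    Filter.Tendsto R (nhdsWithin b (interior X)) Filter.atTop
  third_le : ∀ x ∈ interior X, ∀ h : E n,
    |iteratedFDeriv ℝ 3 R x ![h, h, h]| ≤ 2 * (iteratedFDeriv ℝ 2 R x ![h, h]) ^ (3 / 2 : ℝ)
  first_le : ∀ x ∈ interior X, ∀ h : E n,
    |inner ℝ (gradient R x) h| ≤ √ν * √(iteratedFDeriv ℝ 2 R x ![h, h])

/-- The Hessian matrix of `R` at `x`. -/
def hessian {n : ℕ} (R : E n → ℝ) (x : E n) : Matrix (Fin n) (Fin n) ℝ :=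
  Matrix.of fun j k =>
    iteratedFDeriv ℝ 2 R x ![EuclideanSpace.single j 1, EuclideanSpace.single k 1]

/-- The scaling matrix `(∇²R(x) + c I)^{-1/2}`, the power being that of the functional calculus
of symmetric matrices. -/
def scaling {n : ℕ} (R : E n → ℝ) (c : ℝ) (x : E n) : Matrix (Fin n) (Fin n) ℝ :=
  cfc (fun s : ℝ => s ^ (-(1 / 2) : ℝ)) (hessian R x + c • (1 : Matrix (Fin n) (Fin n) ℝ))

/-- The Bregman divergence `D_R(x', x)`. -/
def bregman {n : ℕ} (R : E n → ℝ) (x' x : E n) : ℝ :=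
  R x' - R x - inner ℝ (gradient R x) (x' - x)

/-- A minimizer of `f` over `s` (an arbitrary point if there is none). -/
def argminOn {n : ℕ} (s : Set (E n)) (f : E n → ℝ) : E n :=
  Classical.epsilon fun x => x ∈ s ∧ ∀ y ∈ s, f x ≤ f y

/-- The prox-mapping with step size `η` and quadratic coefficient `c`; a barrier is infinite off
`interior X`, so that the minimum over `X` is the one over `interior X`. -/
def prox {n : ℕ} (X : Set (E n)) (R : E n → ℝ) (η c : ℝ) (x vhat : E n) : E n :=
  argminOn (interior X) fun x' =>
    η * inner ℝ vhat (x - x') + c / 2 * ‖x - x'‖ ^ 2 + bregman R x' x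

/-- The uniform probability distribution on the unit sphere of `ℝⁿ` (for `n ≥ 1`). -/
def sphereUniform (n : ℕ) : Measure (Metric.sphere (0 : E n) 1) :=
  ((volume : Measure (E n)).toSphere Set.univ)⁻¹ • (volume : Measure (E n)).toSphere

/-! ### The multi-agent eager self-concordant barrier bandit learning algorithm

`η t` are the step sizes, `lam i` the weights, `β` the module, `R i` the barriers and `z t i` the
perturbation direction of player `i` in round `t`. Rounds are numbered `t = 1, 2, …`. -/

section Algorithm

variable {N : ℕ} {d : Fin N → ℕ} (G : SmoothConcaveGame N d) (R : (i : Fin N) → E (d i) → ℝ)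
  (lam : Fin N → ℝ) (β : ℝ) (η : ℕ → ℝ)

/-- The coefficient `η_t β (t+1) / λ_i`. -/
def coeff (t : ℕ) (i : Fin N) : ℝ := η t * β * (t + 1) / lam i

/-- The scaling matrix `A_i^t` for the pivot `x = x^t`. -/
def scalingAt (t : ℕ) (x : Profile d) (i : Fin N) : Matrix (Fin (d i)) (Fin (d i)) ℝ :=
  scaling (R i) (coeff lam β η t i) (x i)

/-- The joint action `x̂^t` played in round `t`, for the pivot `x = x^t` and the
directions `z = z^t`. -/
def play (t : ℕ) (x z : Profile d) : Profile d := fun i =>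
  x i + Matrix.toEuclideanLin (scalingAt R lam β η t x i) (z i)

/-- The gradient estimate `v̂_i^t = n_i u_i(x̂^t) (A_i^t)⁻¹ z_i^t`, from exact bandit feedback. -/
def gradEst (t : ℕ) (x z : Profile d) (i : Fin N) : E (d i) :=
  (d i * G.u i (play R lam β η t x z)) •
    Matrix.toEuclideanLin (scalingAt R lam β η t x i)⁻¹ (z i)

/-- The pivot `x^t` of round `t` (the value at `t = 0` is a placeholder). -/
def pivot (z : ℕ → Profile d) : ℕ → Profile d
  | 0 => fun i => argminOn (interior (G.X i)) (R i)
  | 1 => fun i => argminOn (interior (G.X i)) (R i)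
  | t + 2 => fun i =>
      prox (G.X i) (R i) (η (t + 1)) (coeff lam β η (t + 1) i) (pivot z (t + 1) i)
        (gradEst G R lam β η (t + 1) (pivot z (t + 1)) (z (t + 1)) i)

/-- The joint action `x̂^t` played in round `t` of the algorithm. -/
def played (z : ℕ → Profile d) (t : ℕ) : Profile d :=
  play R lam β η t (pivot G R lam β η z t) (z t)

end Algorithm

/-- The step sizes `η_t = 1 / (2 n L √t)`, where `n = ∑ i, d i`. -/
def stepSize {N : ℕ} (d : Fin N → ℕ) (L : ℝ) (t : ℕ) : ℝ :=
  1 / (2 * (∑ i, d i : ℕ) * L * √t)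

end BanditGame

end

/-!
The Lyapunov function is the weighted Bregman divergence of a comparator `p` from the pivot, plus
`η_t β t / 2` times their squared distance. Averaging each
direction of player `i` with its reflection shows that the single-point estimate `v̂_i` has mean
`v_i` up to the displacement `x̂ - x`, whose square is at most the sum of the inverse coefficients
`λ_i / (η_t β (t + 1))`. Half of the strong monotonicity absorbs this bias through Young's
inequality, the other half lowers the coefficient of the squared distance from `t + 1` to `t`.
Self-concordance makes the prox step cost only `2 (η_t n_i L)² = O(1 / t)` in the local norm, so
the expected potential grows by `O(1 / t)` per round, and by `O(log T)` in total.

The equilibrium may lie on the boundary, where the barrier is infinite, so `p` is taken at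
relative distance `1 / T` from it: there the barrier is `O(log T)`, while the equilibrium
inequality fails by `O(1 / T)` only. At the horizon `η_T β T / 2` is of order `√T`, whence the
rate; the perturbation `x̂ - x` itself has squared length `O(1 / √T)`.
-/

noncomputable section

namespace BanditGame

/-! ### One-dimensional calculus -/

section OneDim

theorem monotoneOn_of_hasDerivAt_nonneg {D : Set ℝ} (hD : Convex ℝ D) {f f' : ℝ → ℝ}
    (hf : ∀ s ∈ D, HasDerivAt f (f' s) s) (hf' : ∀ s ∈ D, 0 ≤ f' s) : MonotoneOn f D :=
  monotoneOn_of_hasDerivWithinAt_nonneg hD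
    (fun s hs => (hf s hs).continuousAt.continuousWithinAt)
    (fun s hs => (hf s (interior_subset hs)).hasDerivWithinAt)
    (fun s hs => hf' s (interior_subset hs))

theorem lipschitzOnWith_inv_sqrt_of_abs_deriv_le {D : Set ℝ} (hD : Convex ℝ D) {ψ ψ' : ℝ → ℝ}
    (hψ : ∀ s ∈ D, HasDerivAt ψ (ψ' s) s) (hpos : ∀ s ∈ D, 0 < ψ s)
    (hle : ∀ s ∈ D, |ψ' s| ≤ 2 * ψ s ^ (3 / 2 : ℝ)) :
    LipschitzOnWith 1 (fun s => (√(ψ s))⁻¹) D := by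
  refine hD.lipschitzOnWith_of_nnnorm_hasDerivWithin_le
    (f' := fun s => -(ψ' s / (2 * √(ψ s))) / √(ψ s) ^ 2)
    (fun s hs => (((hψ s hs).sqrt (hpos s hs).ne').inv
      (Real.sqrt_pos.2 (hpos s hs)).ne').hasDerivWithinAt) fun s hs => ?_
  have hsqrt : 0 < √(ψ s) := Real.sqrt_pos.2 (hpos s hs)
  have hcube : ψ s ^ (3 / 2 : ℝ) = √(ψ s) ^ 3 := by
    rw [Real.sqrt_eq_rpow, ← Real.rpow_natCast, ← Real.rpow_mul (hpos s hs).le]; norm_num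
  have hbound := hcube ▸ hle s hs
  rw [← NNReal.coe_le_coe, coe_nnnorm, Real.norm_eq_abs, abs_div, abs_neg, abs_div,
    abs_of_pos (by positivity : 0 < 2 * √(ψ s)), abs_of_pos (by positivity : 0 < √(ψ s) ^ 2),
    div_div, NNReal.coe_one, div_le_one (by positivity)]
  linarith

theorem sub_sub_deriv_le_of_second_deriv_le {f f' f'' g g' g'' : ℝ → ℝ} {a b : ℝ} (hab : a ≤ b)
    (hf : ∀ s ∈ Set.Icc a b, HasDerivAt f (f' s) s)
    (hf' : ∀ s ∈ Set.Icc a b, HasDerivAt f' (f'' s) s)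
    (hg : ∀ s ∈ Set.Icc a b, HasDerivAt g (g' s) s)
    (hg' : ∀ s ∈ Set.Icc a b, HasDerivAt g' (g'' s) s)
    (hle : ∀ s ∈ Set.Icc a b, f'' s ≤ g'' s) :
    f b - f a - f' a * (b - a) ≤ g b - g a - g' a * (b - a) := by
  have ha : a ∈ Set.Icc a b := Set.left_mem_Icc.2 hab
  have hderiv : MonotoneOn (g' - f') (Set.Icc a b) :=
    monotoneOn_of_hasDerivAt_nonneg (convex_Icc a b) (fun s hs => (hg' s hs).sub (hf' s hs))
      fun s hs => sub_nonneg.2 (hle s hs)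
  have hfun : MonotoneOn (fun s => g s - f s - s * (g' a - f' a)) (Set.Icc a b) :=
    monotoneOn_of_hasDerivAt_nonneg (convex_Icc a b)
      (fun s hs => ((hg s hs).sub (hf s hs)).sub ((hasDerivAt_id s).mul_const _))
      fun s hs => by simpa using hderiv ha hs hs.1
  have := hfun ha (Set.right_mem_Icc.2 hab) hab
  linarith

theorem sub_log_le_of_second_deriv {φ φ' ψ : ℝ → ℝ} {r : ℝ} (hr : 0 ≤ r)
    (hφ : ∀ s ∈ Set.Icc (0 : ℝ) 1, HasDerivAt φ (φ' s) s)
    (hφ' : ∀ s ∈ Set.Icc (0 : ℝ) 1, HasDerivAt φ' (ψ s) s)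
    (hψ : ∀ s ∈ Set.Icc (0 : ℝ) 1, (r / (1 + r * s)) ^ 2 ≤ ψ s) :
    r - Real.log (1 + r) ≤ φ 1 - φ 0 - φ' 0 := by
  have hpos : ∀ s ∈ Set.Icc (0 : ℝ) 1, 1 + r * s ≠ 0 := fun s hs => by
    have := mul_nonneg hr hs.1; positivity
  have hlin : ∀ s : ℝ, HasDerivAt (fun s => 1 + r * s) r s := fun s => by
    simpa using ((hasDerivAt_id s).const_mul r).const_add 1
  have hcomp := sub_sub_deriv_le_of_second_deriv_le zero_le_one
    (f := fun s => r * s - Real.log (1 + r * s)) (f' := fun s => r - r * (1 + r * s)⁻¹)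
    (f'' := fun s => (r / (1 + r * s)) ^ 2)
    (fun s hs => by
      simpa [div_eq_mul_inv] using
        ((hasDerivAt_id' s).const_mul r).fun_sub ((hlin s).log (hpos s hs)))
    (fun s hs => by
      convert! (((hlin s).inv (hpos s hs)).const_mul r).const_sub r using 1
      rw [div_pow]
      ring)
    hφ hφ' hψ
  simpa using hcomp

theorem mul_sub_sub_log_le {l r : ℝ} (hl : l ≤ 1 / 2) (hr : 0 ≤ r) :
    l * r - (r - Real.log (1 + r)) ≤ 2 * l ^ 2 := by
  have hprod : Real.log ((1 - l) * (1 + r)) ≤ (1 - l) * (1 + r) - 1 :=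
    Real.log_le_sub_one_of_pos (mul_pos (by linarith) (by linarith))
  rw [Real.log_mul (by linarith) (by linarith)] at hprod
  have hinv : Real.log (1 - l)⁻¹ ≤ (1 - l)⁻¹ - 1 :=
    Real.log_le_sub_one_of_pos (inv_pos.2 (by linarith))
  rw [Real.log_inv] at hinv
  have hgeom : (1 - l)⁻¹ ≤ 1 + l + 2 * l ^ 2 := by
    rw [inv_le_iff_one_le_mul₀ (by linarith)]
    nlinarith [mul_nonneg (sq_nonneg l) (by linarith : 0 ≤ 1 - 2 * l)]
  linarith

/- While `φ' > 0` the function `-1/φ' - s/ν` increases, so that `φ'` would blow up within time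
`ν / φ' t`; this must not happen before time `1`. -/
theorem deriv_le_div_one_sub_of_sq_le {φ' ψ : ℝ → ℝ} {ν : ℝ} (hν : 0 < ν)
    (hφ' : ∀ s ∈ Set.Ico (0 : ℝ) 1, HasDerivAt φ' (ψ s) s)
    (hle : ∀ s ∈ Set.Ico (0 : ℝ) 1, φ' s ^ 2 ≤ ν * ψ s) {t : ℝ} (ht : t ∈ Set.Ico (0 : ℝ) 1) :
    φ' t ≤ ν / (1 - t) := by
  by_contra! hlt
  have h1t : 0 < 1 - t := sub_pos.2 ht.2
  have hφt : 0 < φ' t := lt_trans (by positivity) hlt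
  have hsub : Set.Ico t 1 ⊆ Set.Ico 0 1 := Set.Ico_subset_Ico_left ht.1
  have hmono : MonotoneOn φ' (Set.Ico 0 1) :=
    monotoneOn_of_hasDerivAt_nonneg (convex_Ico 0 1) hφ' fun s hs =>
      nonneg_of_mul_nonneg_right ((sq_nonneg _).trans (hle s hs)) hν
  have hpos : ∀ q ∈ Set.Ico t 1, 0 < φ' q := fun q hq => hφt.trans_le (hmono ht (hsub hq) hq.1)
  have hinv : MonotoneOn (fun q => -(φ' q)⁻¹ - q / ν) (Set.Ico t 1) := by
    refine monotoneOn_of_hasDerivAt_nonneg (convex_Ico t 1)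
      (fun q hq => ((hφ' q (hsub hq)).inv (hpos q hq).ne').neg.sub
        ((hasDerivAt_id q).div_const ν)) fun q hq => ?_
    have := hpos q hq
    rw [neg_div, neg_neg, sub_nonneg, div_le_div_iff₀ hν (by positivity)]
    linarith [hle q (hsub hq)]
  have hblowup : t + ν / φ' t ∈ Set.Ico t 1 := by
    rw [div_lt_comm₀ h1t hφt] at hlt
    exact ⟨le_add_of_nonneg_right (by positivity), by linarith⟩
  have hcontra := hinv ⟨le_rfl, ht.2⟩ hblowup hblowup.1
  simp only [add_div, div_div_cancel_left' hν.ne'] at hcontra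
  linarith [inv_pos.2 (hpos _ hblowup)]

theorem sub_le_neg_mul_log_of_sq_deriv_le {φ φ' ψ : ℝ → ℝ} {ν : ℝ} (hν : 0 < ν)
    (hφ : ∀ s ∈ Set.Ico (0 : ℝ) 1, HasDerivAt φ (φ' s) s)
    (hφ' : ∀ s ∈ Set.Ico (0 : ℝ) 1, HasDerivAt φ' (ψ s) s)
    (hle : ∀ s ∈ Set.Ico (0 : ℝ) 1, φ' s ^ 2 ≤ ν * ψ s) {s : ℝ} (hs : s ∈ Set.Ico (0 : ℝ) 1) :
    φ s - φ 0 ≤ -ν * Real.log (1 - s) := by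
  have hmono : MonotoneOn (fun t => -ν * Real.log (1 - t) - φ t) (Set.Ico 0 1) :=
    monotoneOn_of_hasDerivAt_nonneg (convex_Ico 0 1)
      (fun t ht => ((((hasDerivAt_id t).const_sub 1).log (sub_pos.2 ht.2).ne').const_mul
        (-ν)).sub (hφ t ht)) fun t ht => by
      have := deriv_le_div_one_sub_of_sq_le hν hφ' hle ht
      rw [neg_mul, neg_div, mul_neg, neg_neg, mul_one_div, sub_nonneg]
      exact this
  have := hmono ⟨le_rfl, zero_lt_one⟩ hs hs.1
  simp only [sub_zero, Real.log_one, mul_zero, zero_sub] at this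
  linarith

end OneDim

/-! ### Self-concordant barriers -/

section Barrier

theorem exists_first_exit {F : Type*} [AddCommGroup F] [Module ℝ F] [TopologicalSpace F]
    [ContinuousAdd F] [ContinuousSMul ℝ F] {U : Set F} (hU : IsOpen U) {x h : F} (hx : x ∈ U)
    (hxh : x + h ∉ U) :
    ∃ b ∈ Set.Ioc (0 : ℝ) 1, x + b • h ∉ U ∧ ∀ s ∈ Set.Ico 0 b, x + s • h ∈ U := by
  have hcomp : IsCompact (Set.Icc (0 : ℝ) 1 ∩ (fun s : ℝ => x + s • h) ⁻¹' Uᶜ) :=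
    isCompact_Icc.inter_right (hU.isClosed_compl.preimage (by fun_prop))
  obtain ⟨b, ⟨hb01, hbU⟩, hbmin⟩ := hcomp.exists_isLeast ⟨1, by simp, by simpa using hxh⟩
  refine ⟨b, ⟨hb01.1.lt_of_ne' fun hb0 => hbU ?_, hb01.2⟩, hbU, fun s hs => ?_⟩
  · simpa [hb0] using hx
  · by_contra hsU
    exact (hbmin ⟨⟨hs.1, hs.2.le.trans hb01.2⟩, hsU⟩).not_gt hs.2

theorem hasDerivAt_iteratedFDeriv_line {F G : Type*} [NormedAddCommGroup F] [NormedSpace ℝ F]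
    [NormedAddCommGroup G] [NormedSpace ℝ G] {k : ℕ} {m : ℕ∞} (hk : (k : ℕ∞) < m) {f : F → G}
    {x h : F} {s : ℝ} (hf : ContDiffAt ℝ m f (x + s • h)) :
    HasDerivAt (fun s : ℝ => iteratedFDeriv ℝ k f (x + s • h) (fun _ => h))
      (iteratedFDeriv ℝ (k + 1) f (x + s • h) (fun _ => h)) s := by
  have hline : HasDerivAt (fun s : ℝ => x + s • h) h s := by
    simpa using ((hasDerivAt_id s).smul_const h).const_add x
  exact (ContinuousMultilinearMap.apply ℝ (fun _ : Fin k => F) G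
    (fun _ => h)).hasFDerivAt.comp_hasDerivAt s
      ((hf.differentiableAt_iteratedFDeriv (mod_cast hk)).hasFDerivAt.comp_hasDerivAt s hline)

theorem add_smul_mem_interior {F : Type*} [AddCommGroup F] [Module ℝ F] [TopologicalSpace F]
    [IsTopologicalAddGroup F] [ContinuousConstSMul ℝ F] {X : Set F} (hX : Convex ℝ X) {x h : F}
    (hx : x ∈ interior X) (hxh : x + h ∈ interior X) {s : ℝ} (hs : s ∈ Set.Icc (0 : ℝ) 1) :
    x + s • h ∈ interior X := by
  convert hX.interior hx hxh (sub_nonneg.2 hs.2) hs.1 (by ring) using 1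
  module

theorem argminOn_mem_and_isMinOn {n : ℕ} {s : Set (E n)} {f : E n → ℝ}
    (h : ∃ x ∈ s, IsMinOn f s x) : argminOn s f ∈ s ∧ IsMinOn f s (argminOn s f) :=
  Classical.epsilon_spec (p := fun x => x ∈ s ∧ ∀ y ∈ s, f x ≤ f y) h

/-- The quadratic form `h ↦ hᵀ ∇²R(x) h`, the square of the local norm of `R` at `x`. -/
def hessForm {n : ℕ} (R : E n → ℝ) (x h : E n) : ℝ := iteratedFDeriv ℝ 2 R x ![h, h]

theorem hessForm_eq {n : ℕ} (R : E n → ℝ) (x h : E n) :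
    hessForm R x h = iteratedFDeriv ℝ 2 R x (fun _ => h) := by
  unfold hessForm
  congr 1
  ext i
  fin_cases i <;> rfl

theorem bregman_add_sq_eq_of_gradient_eq {n : ℕ} {R : E n → ℝ} {c η : ℝ} {x y w : E n}
    (hy : gradient R y + c • y = gradient R x + c • x + η • w) (p : E n) :
    bregman R p y + c / 2 * ‖p - y‖ ^ 2 =
      bregman R p x + c / 2 * ‖p - x‖ ^ 2 + η * inner ℝ w (x - p) +
        (η * inner ℝ w (y - x) - (bregman R y x + c / 2 * ‖y - x‖ ^ 2)) := by
  rw [← eq_sub_iff_add_eq] at hy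
  simp only [bregman, hy, norm_sub_sq_real, inner_add_left, inner_sub_left, inner_sub_right,
    inner_smul_left, RCLike.conj_to_real, real_inner_self_eq_norm_sq, real_inner_comm x p,
    real_inner_comm y p, real_inner_comm x y]
  ring

namespace IsSelfConcordantBarrier

variable {n : ℕ} {X : Set (E n)} {ν : ℝ} {R : E n → ℝ}

theorem contDiffAt (hb : IsSelfConcordantBarrier X ν R) {x : E n} (hx : x ∈ interior X) :
    ContDiffAt ℝ ((3 : ℕ∞) : WithTop ℕ∞) R x :=
  hb.contDiffOn.contDiffAt (isOpen_interior.mem_nhds hx)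

theorem differentiableAt (hb : IsSelfConcordantBarrier X ν R) {x : E n} (hx : x ∈ interior X) :
    DifferentiableAt ℝ R x :=
  (hb.contDiffAt hx).differentiableAt (by norm_num)

theorem continuousOn_gradient (hb : IsSelfConcordantBarrier X ν R) :
    ContinuousOn (gradient R) (interior X) :=
  (InnerProductSpace.toDual ℝ (E n)).symm.continuous.comp_continuousOn
    (hb.contDiffOn.continuousOn_fderiv_of_isOpen isOpen_interior (by norm_num))

theorem hasDerivAt_line (hb : IsSelfConcordantBarrier X ν R) {x h : E n} {s : ℝ}
    (hx : x + s • h ∈ interior X) :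
    HasDerivAt (fun s : ℝ => R (x + s • h)) (inner ℝ (gradient R (x + s • h)) h) s := by
  have := hasDerivAt_iteratedFDeriv_line (k := 0) (by norm_num) (hb.contDiffAt hx)
  simpa [inner_gradient_left, iteratedFDeriv_one_apply] using this

theorem hasDerivAt_gradient_line (hb : IsSelfConcordantBarrier X ν R) {x h : E n} {s : ℝ}
    (hx : x + s • h ∈ interior X) :
    HasDerivAt (fun s : ℝ => inner ℝ (gradient R (x + s • h)) h) (hessForm R (x + s • h) h) s := by
  have := hasDerivAt_iteratedFDeriv_line (k := 1) (by norm_num) (hb.contDiffAt hx)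
  simpa [inner_gradient_left, iteratedFDeriv_one_apply, hessForm_eq] using this

theorem hasDerivAt_hessForm_line (hb : IsSelfConcordantBarrier X ν R) {x h : E n} {s : ℝ}
    (hx : x + s • h ∈ interior X) :
    HasDerivAt (fun s : ℝ => hessForm R (x + s • h) h)
      (iteratedFDeriv ℝ 3 R (x + s • h) ![h, h, h]) s := by
  have hconst : (![h, h, h] : Fin 3 → E n) = fun _ => h := by ext i; fin_cases i <;> rfl
  simpa only [hessForm_eq, hconst] using
    hasDerivAt_iteratedFDeriv_line (k := 2) (by norm_num) (hb.contDiffAt hx)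

theorem hessForm_nonneg (hb : IsSelfConcordantBarrier X ν R) {x : E n} (hx : x ∈ interior X)
    (h : E n) : 0 ≤ hessForm R x h := by
  let S : Set ℝ := (fun s : ℝ => x + s • h) ⁻¹' interior X
  have hS : IsOpen S := isOpen_interior.preimage (by fun_prop)
  have h0 : (0 : ℝ) ∈ S := by simpa [S] using hx
  have hline : ⇑(AffineMap.lineMap x (x + h) : ℝ →ᵃ[ℝ] E n) = fun s : ℝ => x + s • h := by
    funext s
    simp [AffineMap.lineMap_apply, add_comm]
  have hconv : ConvexOn ℝ S (fun s : ℝ => R (x + s • h)) := by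
    have := hb.convexOn.comp_affineMap (AffineMap.lineMap x (x + h) : ℝ →ᵃ[ℝ] E n)
    rwa [hline] at this
  have hmono : MonotoneOn (fun s : ℝ => inner ℝ (gradient R (x + s • h)) h) S :=
    (hconv.monotoneOn_deriv fun s hs => (hb.hasDerivAt_line hs).differentiableAt).congr
      fun s hs => (hb.hasDerivAt_line hs).deriv
  have := hmono.derivWithin_nonneg (x := 0)
  rw [derivWithin_of_isOpen hS h0, (hb.hasDerivAt_gradient_line h0).deriv] at this
  simpa using this

theorem abs_inv_sqrt_hessForm_sub_le (hb : IsSelfConcordantBarrier X ν R) {x h : E n} {ε b : ℝ}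
    (hε : 0 < ε) (hseg : ∀ s ∈ Set.Icc 0 b, x + s • h ∈ interior X) (hb0 : 0 ≤ b) :
    |(√(hessForm R (x + b • h) h + ε))⁻¹ - (√(hessForm R x h + ε))⁻¹| ≤ b := by
  have hlip := lipschitzOnWith_inv_sqrt_of_abs_deriv_le (convex_Icc 0 b)
    (ψ := fun s => hessForm R (x + s • h) h + ε)
    (fun s hs => (hb.hasDerivAt_hessForm_line (hseg s hs)).add_const ε)
    (fun s hs => add_pos_of_nonneg_of_pos (hb.hessForm_nonneg (hseg s hs) h) hε)
    (fun s hs => (hb.third_le _ (hseg s hs) h).trans <| by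
      have := hb.hessForm_nonneg (hseg s hs) h
      gcongr
      exact le_add_of_nonneg_right hε.le)
  simpa [Real.dist_eq, abs_of_nonneg hb0] using
    hlip.dist_le_mul b (Set.right_mem_Icc.2 hb0) 0 (Set.left_mem_Icc.2 hb0)

theorem sq_div_one_add_le_hessForm (hb : IsSelfConcordantBarrier X ν R) {x h : E n} {ε b : ℝ}
    (hε : 0 < ε) (hseg : ∀ s ∈ Set.Icc 0 b, x + s • h ∈ interior X) (hb0 : 0 ≤ b) :
    (√(hessForm R x h + ε) / (1 + √(hessForm R x h + ε) * b)) ^ 2 ≤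
      hessForm R (x + b • h) h + ε := by
  have hx : x ∈ interior X := by simpa using hseg 0 (Set.left_mem_Icc.2 hb0)
  have hr : 0 < √(hessForm R x h + ε) :=
    Real.sqrt_pos.2 (add_pos_of_nonneg_of_pos (hb.hessForm_nonneg hx h) hε)
  have hpos := add_pos_of_nonneg_of_pos
    (hb.hessForm_nonneg (hseg b (Set.right_mem_Icc.2 hb0)) h) hε
  have hlip := (abs_le.1 (hb.abs_inv_sqrt_hessForm_sub_le hε hseg hb0)).2
  have hdiv : ∀ r > 0, r / (1 + r * b) = (r⁻¹ + b)⁻¹ := fun r hr => by field_simp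
  rw [hdiv _ hr]
  refine (pow_le_pow_left₀ (by positivity) ?_ 2).trans_eq (Real.sq_sqrt hpos.le)
  rw [inv_le_comm₀ (by positivity) (Real.sqrt_pos.2 hpos)]
  linarith

theorem hessForm_le_sq_div_one_sub (hb : IsSelfConcordantBarrier X ν R) {x h : E n} {ε b : ℝ}
    (hε : 0 < ε) (hseg : ∀ s ∈ Set.Icc 0 b, x + s • h ∈ interior X) (hb0 : 0 ≤ b)
    (hlt : √(hessForm R x h + ε) * b < 1) :
    hessForm R (x + b • h) h + ε ≤
      (√(hessForm R x h + ε) / (1 - √(hessForm R x h + ε) * b)) ^ 2 := by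
  have hx : x ∈ interior X := by simpa using hseg 0 (Set.left_mem_Icc.2 hb0)
  have hr : 0 < √(hessForm R x h + ε) :=
    Real.sqrt_pos.2 (add_pos_of_nonneg_of_pos (hb.hessForm_nonneg hx h) hε)
  have hpos := add_pos_of_nonneg_of_pos
    (hb.hessForm_nonneg (hseg b (Set.right_mem_Icc.2 hb0)) h) hε
  have hlip := (abs_le.1 (hb.abs_inv_sqrt_hessForm_sub_le hε hseg hb0)).1
  have hdiv : ∀ r > 0, r / (1 - r * b) = (r⁻¹ - b)⁻¹ := fun r hr => by
    rw [← inv_div, sub_div, one_div, mul_div_cancel_left₀ _ hr.ne']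
  have hgap : 0 < (√(hessForm R x h + ε))⁻¹ - b := by
    rwa [sub_pos, ← one_div, lt_div_iff₀' hr]
  rw [hdiv _ hr]
  refine (Real.sq_sqrt hpos.le).symm.trans_le (pow_le_pow_left₀ (Real.sqrt_nonneg _) ?_ 2)
  rw [le_inv_comm₀ (Real.sqrt_pos.2 hpos) hgap]
  linarith

theorem sub_log_le_bregman (hb : IsSelfConcordantBarrier X ν R) (hX : Convex ℝ X) {x h : E n}
    (hx : x ∈ interior X) (hxh : x + h ∈ interior X) {c : ℝ} (hc : 0 < c) :
    √(hessForm R x h + c * ‖h‖ ^ 2) - Real.log (1 + √(hessForm R x h + c * ‖h‖ ^ 2)) ≤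
      bregman R (x + h) x + c / 2 * ‖h‖ ^ 2 := by
  rcases eq_or_ne h 0 with rfl | h0
  · have : hessForm R x 0 = 0 := (hessForm_eq R x 0).trans (ContinuousMultilinearMap.map_zero _)
    simp [this, bregman]
  have hseg : ∀ s ∈ Set.Icc (0 : ℝ) 1, x + s • h ∈ interior X :=
    fun s hs => add_smul_mem_interior hX hx hxh hs
  have hcomp := sub_log_le_of_second_deriv (r := √(hessForm R x h + c * ‖h‖ ^ 2))
    (φ := fun s => R (x + s • h) + c / 2 * ‖h‖ ^ 2 * s ^ 2)
    (φ' := fun s => inner ℝ (gradient R (x + s • h)) h + c * ‖h‖ ^ 2 * s)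
    (ψ := fun s => hessForm R (x + s • h) h + c * ‖h‖ ^ 2) (Real.sqrt_nonneg _)
    (fun s hs => by
      convert! (hb.hasDerivAt_line (hseg s hs)).add
        ((hasDerivAt_pow 2 s).const_mul (c / 2 * ‖h‖ ^ 2)) using 1
      norm_num
      ring)
    (fun s hs => by
      convert! (hb.hasDerivAt_gradient_line (hseg s hs)).add
        ((hasDerivAt_id s).const_mul (c * ‖h‖ ^ 2)) using 1
      simp)
    (fun s hs => hb.sq_div_one_add_le_hessForm (by positivity)
      (fun t ht => hseg t ⟨ht.1, ht.2.trans hs.2⟩) hs.1)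
  simp only [one_smul, zero_smul, add_zero] at hcomp
  simp only [bregman, add_sub_cancel_left]
  linarith

theorem bregman_nonneg (hb : IsSelfConcordantBarrier X ν R) (hX : Convex ℝ X) {x y : E n}
    (hx : x ∈ interior X) (hy : y ∈ interior X) : 0 ≤ bregman R y x := by
  have hseg : ∀ s ∈ Set.Icc (0 : ℝ) 1, x + s • (y - x) ∈ interior X :=
    fun s hs => add_smul_mem_interior hX hx (by simpa using hy) hs
  have hcomp := sub_sub_deriv_le_of_second_deriv_le zero_le_one
    (fun s _ => hasDerivAt_const s (0 : ℝ)) (fun s _ => hasDerivAt_const s (0 : ℝ))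
    (fun s hs => hb.hasDerivAt_line (hseg s hs))
    (fun s hs => hb.hasDerivAt_gradient_line (hseg s hs))
    (fun s hs => hb.hessForm_nonneg (hseg s hs) (y - x))
  simpa [bregman] using hcomp

theorem gradient_monotone (hb : IsSelfConcordantBarrier X ν R) (hX : Convex ℝ X) {x y : E n}
    (hx : x ∈ interior X) (hy : y ∈ interior X) :
    0 ≤ inner ℝ (gradient R x - gradient R y) (x - y) := by
  have hyx := hb.bregman_nonneg hX hx hy
  have hxy := hb.bregman_nonneg hX hy hx
  simp only [bregman, inner_sub_left, inner_sub_right] at *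
  linarith

theorem gradient_strongly_monotone (hb : IsSelfConcordantBarrier X ν R) (hX : Convex ℝ X) {c : ℝ}
    {x y : E n} (hx : x ∈ interior X) (hy : y ∈ interior X) :
    c * ‖x - y‖ ^ 2 ≤
      inner ℝ ((gradient R x + c • x) - (gradient R y + c • y)) (x - y) := by
  rw [add_sub_add_comm, ← smul_sub, inner_add_left, real_inner_smul_left,
    real_inner_self_eq_norm_sq]
  exact le_add_of_nonneg_left (hb.gradient_monotone hX hx hy)

theorem tendsto_line_atTop_of_exit (hb : IsSelfConcordantBarrier X ν R) {x h : E n} {b : ℝ}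
    (hb0 : 0 < b) (hbX : x + b • h ∉ interior X)
    (hseg : ∀ s ∈ Set.Ico 0 b, x + s • h ∈ interior X) :
    Filter.Tendsto (fun s : ℝ => R (x + s • h)) (nhdsWithin b (Set.Ico 0 b)) Filter.atTop := by
  have hline : Filter.Tendsto (fun s : ℝ => x + s • h) (nhdsWithin b (Set.Ico 0 b))
      (nhdsWithin (x + b • h) (interior X)) :=
    tendsto_nhdsWithin_of_tendsto_nhds_of_eventually_within _
      ((Continuous.tendsto (by fun_prop) b).mono_left nhdsWithin_le_nhds)
      (eventually_mem_nhdsWithin.mono hseg)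
  have : (nhdsWithin b (Set.Ico 0 b)).NeBot := by
    rw [← mem_closure_iff_nhdsWithin_neBot, closure_Ico hb0.ne]
    exact Set.right_mem_Icc.2 hb0.le
  exact (hb.tendsto_atTop _
    ⟨closure_mono interior_subset (mem_closure_iff_nhdsWithin_neBot.2 hline.neBot), hbX⟩).comp hline

/- The Dikin ellipsoid: until a segment leaves the interior the second derivative of `R` along it
stays bounded, so that `R` cannot blow up at the exit point. -/
theorem add_mem_interior (hb : IsSelfConcordantBarrier X ν R) {x h : E n}
    (hx : x ∈ interior X) (hh : hessForm R x h < 1) : x + h ∈ interior X := by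
  by_contra hxh
  obtain ⟨b, ⟨hb0, hb1⟩, hbX, hseg⟩ := exists_first_exit isOpen_interior hx hxh
  have hIcc : ∀ s ∈ Set.Ico 0 b, ∀ t ∈ Set.Icc 0 s, x + t • h ∈ interior X :=
    fun s hs t ht => hseg t ⟨ht.1, ht.2.trans_lt hs.2⟩
  obtain ⟨ε, hε, hε1⟩ : ∃ ε > 0, hessForm R x h + ε < 1 :=
    ⟨(1 - hessForm R x h) / 2, by linarith, by linarith⟩
  set r := √(hessForm R x h + ε)
  have hr : r < 1 := (Real.sqrt_lt' one_pos).2 (by simpa using hε1)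
  have hr0 : 0 ≤ r := Real.sqrt_nonneg _
  let K := (r / (1 - r)) ^ 2
  have hhess : ∀ s ∈ Set.Ico 0 b, hessForm R (x + s • h) h ≤ K := fun s hs => by
    have hrs : r * s ≤ r := mul_le_of_le_one_right hr0 (hs.2.le.trans hb1)
    refine (le_add_of_nonneg_right hε.le).trans <|
      (hb.hessForm_le_sq_div_one_sub hε (hIcc s hs) hs.1 (hrs.trans_lt hr)).trans ?_
    exact pow_le_pow_left₀ (div_nonneg hr0 (by linarith))
      (div_le_div_of_nonneg_left hr0 (by linarith) (by linarith)) 2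
  have hbound : ∀ s ∈ Set.Ico 0 b, R (x + s • h) ≤ R x + |inner ℝ (gradient R x) h| + K / 2 :=
      fun s hs => by
    have hs1 : s ≤ 1 := hs.2.le.trans hb1
    have hcomp := sub_sub_deriv_le_of_second_deriv_le hs.1
      (g := fun t => K / 2 * t ^ 2) (g' := fun t => K * t) (g'' := fun _ => K)
      (fun t ht => hb.hasDerivAt_line (hIcc s hs t ht))
      (fun t ht => hb.hasDerivAt_gradient_line (hIcc s hs t ht))
      (fun t _ => by
        convert! (hasDerivAt_pow 2 t).const_mul (K / 2) using 1
        norm_num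
        ring)
      (fun t _ => by simpa using (hasDerivAt_id t).const_mul K)
      (fun t ht => hhess t ⟨ht.1, ht.2.trans_lt hs.2⟩)
    have hlin : inner ℝ (gradient R x) h * s ≤ |inner ℝ (gradient R x) h| :=
      (le_abs_self _).trans <| by
        rw [abs_mul, abs_of_nonneg hs.1]
        exact mul_le_of_le_one_right (abs_nonneg _) hs1
    have hquad : K / 2 * s ^ 2 ≤ K / 2 :=
      mul_le_of_le_one_right (by positivity) (pow_le_one₀ hs.1 hs1)
    simp only [zero_smul, add_zero, sub_zero] at hcomp
    linarith
  have : (nhdsWithin b (Set.Ico 0 b)).NeBot := by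
    rw [← mem_closure_iff_nhdsWithin_neBot, closure_Ico hb0.ne]
    exact Set.right_mem_Icc.2 hb0.le
  obtain ⟨s, hlt, hs⟩ := (((hb.tendsto_line_atTop_of_exit hb0 hbX hseg).eventually_gt_atTop
    _).and self_mem_nhdsWithin).exists
  exact (hbound s hs).not_gt hlt

theorem sub_le_neg_mul_log (hb : IsSelfConcordantBarrier X ν R) (hX : Convex ℝ X) {κ : ℝ}
    (hκ : 0 < κ) (hνκ : ν ≤ κ) {x y : E n} (hx : x ∈ interior X) (hy : y ∈ X) {s : ℝ}
    (hs : s ∈ Set.Ico (0 : ℝ) 1) :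
    R (x + s • (y - x)) - R x ≤ -κ * Real.log (1 - s) := by
  have hseg : ∀ s ∈ Set.Ico (0 : ℝ) 1, x + s • (y - x) ∈ interior X := fun s hs => by
    convert hX.add_smul_sub_mem_interior hy hx (t := 1 - s) ⟨sub_pos.2 hs.2, by linarith [hs.1]⟩
      using 1
    module
  have hfirst : ∀ s ∈ Set.Ico (0 : ℝ) 1, inner ℝ (gradient R (x + s • (y - x))) (y - x) ^ 2 ≤
      κ * hessForm R (x + s • (y - x)) (y - x) := fun s hs => by
    have hle : |inner ℝ (gradient R (x + s • (y - x))) (y - x)| ≤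
        √κ * √(hessForm R (x + s • (y - x)) (y - x)) :=
      (hb.first_le _ (hseg s hs) (y - x)).trans (by gcongr; rfl)
    rwa [← Real.sqrt_mul hκ.le, ← Real.sqrt_sq_eq_abs, Real.sqrt_le_sqrt_iff
      (mul_nonneg hκ.le (hb.hessForm_nonneg (hseg s hs) _))] at hle
  simpa using sub_le_neg_mul_log_of_sq_deriv_le hκ
    (fun s hs => hb.hasDerivAt_line (hseg s hs))
    (fun s hs => hb.hasDerivAt_gradient_line (hseg s hs)) hfirst hs

theorem isCompact_inter_setOf_add_le (hb : IsSelfConcordantBarrier X ν R) (hX : IsCompact X)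
    {g : E n → ℝ} (hg : Continuous g) (a : ℝ) :
    IsCompact (interior X ∩ {x | R x + g x ≤ a}) := by
  refine hX.of_isClosed_subset (isClosed_of_closure_subset fun b hbK => ?_)
    fun x hx => interior_subset hx.1
  set K := interior X ∩ {x | R x + g x ≤ a}
  have : (nhdsWithin b K).NeBot := mem_closure_iff_nhdsWithin_neBot.1 hbK
  have hle : ∀ᶠ x in nhdsWithin b K, R x + g x ≤ a :=
    eventually_mem_nhdsWithin.mono fun x hx => hx.2
  have hmono : nhdsWithin b K ≤ nhdsWithin b (interior X) :=
    nhdsWithin_mono _ Set.inter_subset_left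
  by_cases hbX : b ∈ interior X
  · exact ⟨hbX, le_of_tendsto
      (((hb.contDiffOn.continuousOn.add hg.continuousOn) b hbX).mono_left hmono) hle⟩
  · have hfr : b ∈ frontier X := ⟨closure_mono (fun x hx => interior_subset hx.1) hbK, hbX⟩
    have hatTop := ((hb.tendsto_atTop b hfr).mono_left hmono).atTop_add
      ((hg.tendsto b).mono_left (nhdsWithin_le_nhds (s := K)))
    obtain ⟨x, hlt, hxa⟩ := ((hatTop.eventually_gt_atTop a).and hle).exists
    exact absurd hxa hlt.not_ge

theorem exists_isMinOn (hb : IsSelfConcordantBarrier X ν R) (hX : IsCompact X)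
    (hne : (interior X).Nonempty) {g : E n → ℝ} (hg : Continuous g) :
    ∃ x ∈ interior X, IsMinOn (fun x => R x + g x) (interior X) x := by
  obtain ⟨x₀, hx₀⟩ := hne
  obtain ⟨x, ⟨hx, hxx₀⟩, hmin⟩ :=
    (hb.isCompact_inter_setOf_add_le hX hg (R x₀ + g x₀)).exists_isMinOn
      ⟨x₀, hx₀, le_refl (R x₀ + g x₀)⟩ ((hb.contDiffOn.continuousOn.add
        hg.continuousOn).mono Set.inter_subset_left)
  refine ⟨x, hx, fun y hy => ?_⟩
  rcases le_total (R y + g y) (R x₀ + g x₀) with hle | hge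
  · exact hmin ⟨hy, hle⟩
  · exact hxx₀.trans hge

theorem argminOn_spec (hb : IsSelfConcordantBarrier X ν R) (hX : IsCompact X)
    (hne : (interior X).Nonempty) :
    argminOn (interior X) R ∈ interior X ∧ IsMinOn R (interior X) (argminOn (interior X) R) :=
  argminOn_mem_and_isMinOn <| by
    simpa using hb.exists_isMinOn hX hne (g := fun _ => 0) continuous_const

theorem gradient_argminOn (hb : IsSelfConcordantBarrier X ν R) (hX : IsCompact X)
    (hne : (interior X).Nonempty) : gradient R (argminOn (interior X) R) = 0 := by
  obtain ⟨hmem, hmin⟩ := hb.argminOn_spec hX hne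
  simp [gradient, (hmin.isLocalMin (isOpen_interior.mem_nhds hmem)).fderiv_eq_zero]

theorem prox_spec (hb : IsSelfConcordantBarrier X ν R) (hX : IsCompact X) (η c : ℝ) {x : E n}
    (hx : x ∈ interior X) (w : E n) :
    prox X R η c x w ∈ interior X ∧
      IsMinOn (fun y => η * inner ℝ w (x - y) + c / 2 * ‖x - y‖ ^ 2 + bregman R y x)
        (interior X) (prox X R η c x w) :=
  argminOn_mem_and_isMinOn <| by
    convert hb.exists_isMinOn hX ⟨x, hx⟩ (g := fun y => η * inner ℝ w (x - y) +
      c / 2 * ‖x - y‖ ^ 2 - R x - inner ℝ (gradient R x) (y - x)) (by fun_prop) using 4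
    ext y
    unfold bregman
    ring

theorem gradient_prox (hb : IsSelfConcordantBarrier X ν R) (hX : IsCompact X) (η c : ℝ) {x : E n}
    (hx : x ∈ interior X) (w : E n) :
    gradient R (prox X R η c x w) + c • prox X R η c x w = gradient R x + c • x + η • w := by
  obtain ⟨hmem, hmin⟩ := hb.prox_spec hX η c hx w
  set p := prox X R η c x w
  have hsub : HasFDerivAt (fun y : E n => x - y) (-ContinuousLinearMap.id ℝ (E n)) p :=
    (hasFDerivAt_id p).const_sub x
  have hlinear := (innerSL ℝ w).hasFDerivAt.comp p hsub
  have hbregman := ((hb.differentiableAt hmem).hasFDerivAt.sub_const (R x)).sub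
    ((innerSL ℝ (gradient R x)).hasFDerivAt.comp p ((hasFDerivAt_id p).sub_const x))
  have hzero := (hmin.isLocalMin (isOpen_interior.mem_nhds hmem)).hasFDerivAt_eq_zero
    (((hlinear.const_mul η).add (hsub.norm_sq.const_mul (c / 2))).add hbregman)
  refine ext_inner_right ℝ fun k => ?_
  have hk := congrArg (fun f => f k) hzero
  simp only [ContinuousLinearMap.comp_neg, ContinuousLinearMap.comp_id, smul_neg, map_sub, neg_sub,
    add_apply, neg_apply, smul_apply, coe_innerSL_apply, smul_eq_mul, sub_apply, nsmul_eq_mul,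
    Nat.cast_ofNat, ← inner_gradient_left, zero_apply] at hk
  simp only [inner_add_left, inner_smul_left, RCLike.conj_to_real]
  linarith

theorem norm_prox_sub_prox_le (hb : IsSelfConcordantBarrier X ν R) (hXc : IsCompact X)
    (hX : Convex ℝ X) {η c : ℝ} (hc : 0 < c) {x y w w' : E n} (hx : x ∈ interior X)
    (hy : y ∈ interior X) :
    ‖prox X R η c x w - prox X R η c y w'‖ ≤
      c⁻¹ * ‖(gradient R x + c • x + η • w) - (gradient R y + c • y + η • w')‖ := by
  have hmono := hb.gradient_strongly_monotone hX (c := c) (hb.prox_spec hXc η c hx w).1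
    (hb.prox_spec hXc η c hy w').1
  rw [hb.gradient_prox hXc η c hx w, hb.gradient_prox hXc η c hy w'] at hmono
  have hle := hmono.trans (real_inner_le_norm _ _)
  rw [inv_mul_eq_div, le_div_iff₀' hc]
  rcases (norm_nonneg (prox X R η c x w - prox X R η c y w')).eq_or_lt with hzero | hpos
  · rw [← hzero, mul_zero]
    exact norm_nonneg _
  · exact le_of_mul_le_mul_right (by rwa [sq, ← mul_assoc] at hle) hpos

theorem continuousOn_prox (hb : IsSelfConcordantBarrier X ν R) (hXc : IsCompact X)
    (hX : Convex ℝ X) {η c : ℝ} (hc : 0 < c) {α : Type*} [TopologicalSpace α] {S : Set α}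
    {x w : α → E n} (hx : ContinuousOn x S) (hw : ContinuousOn w S)
    (hxS : ∀ a ∈ S, x a ∈ interior X) :
    ContinuousOn (fun a => prox X R η c (x a) (w a)) S := by
  have hdual : ContinuousOn (fun a => gradient R (x a) + c • x a + η • w a) S :=
    ((hb.continuousOn_gradient.comp hx hxS).add (hx.const_smul c)).add (hw.const_smul η)
  intro a ha
  rw [ContinuousWithinAt, tendsto_iff_norm_sub_tendsto_zero]
  have hlim := (tendsto_iff_norm_sub_tendsto_zero.1 (hdual a ha)).const_mul c⁻¹
  rw [mul_zero] at hlim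
  refine squeeze_zero' (Filter.Eventually.of_forall fun _ => norm_nonneg _) ?_ hlim
  filter_upwards [self_mem_nhdsWithin] with b hb'
  exact hb.norm_prox_sub_prox_le hXc hX hc (hxS b hb') (hxS a ha)

theorem bregman_prox_add_sq_le (hb : IsSelfConcordantBarrier X ν R) (hXc : IsCompact X)
    (hX : Convex ℝ X) {η c l : ℝ} (hc : 0 < c) (hl : l ≤ 1 / 2) {x p w : E n}
    (hx : x ∈ interior X)
    (hw : ∀ h : E n, η * inner ℝ w h ≤ l * √(hessForm R x h + c * ‖h‖ ^ 2)) :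
    bregman R p (prox X R η c x w) + c / 2 * ‖p - prox X R η c x w‖ ^ 2 ≤
      bregman R p x + c / 2 * ‖p - x‖ ^ 2 + η * inner ℝ w (x - p) + 2 * l ^ 2 := by
  rw [bregman_add_sq_eq_of_gradient_eq (hb.gradient_prox hXc η c hx w)]
  have hy := (hb.prox_spec hXc η c hx w).1
  set y := prox X R η c x w
  have hbreg := hb.sub_log_le_bregman hX (h := y - x) hx (by simpa using hy) hc
  rw [add_sub_cancel] at hbreg
  linarith [hw (y - x), mul_sub_sub_log_le hl
    (Real.sqrt_nonneg (hessForm R x (y - x) + c * ‖y - x‖ ^ 2))]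

end IsSelfConcordantBarrier

end Barrier

/-! ### The scaling matrices -/

section Scaling

theorem continuousOn_rpow_neg_half {s : Set ℝ} (hs : ∀ t ∈ s, 0 < t) :
    ContinuousOn (fun t : ℝ => t ^ (-(1 / 2) : ℝ)) s :=
  fun t ht => (Real.continuousAt_rpow_const t _ (Or.inl (hs t ht).ne')).continuousWithinAt

theorem cfc_rpow_neg_half_mul_self_mul {A : Type*} [Ring A] [StarRing A] [TopologicalSpace A]
    [Algebra ℝ A] [ContinuousFunctionalCalculus ℝ A IsSelfAdjoint] {a : A} (ha : IsSelfAdjoint a)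
    (hpos : ∀ t ∈ spectrum ℝ a, 0 < t) :
    cfc (fun s : ℝ => s ^ (-(1 / 2) : ℝ)) a *
      (a * cfc (fun s : ℝ => s ^ (-(1 / 2) : ℝ)) a) = 1 := by
  have hf := continuousOn_rpow_neg_half hpos
  conv_lhs => enter [2, 1]; rw [← cfc_id' ℝ a]
  rw [← cfc_mul (fun s : ℝ => s) (fun s : ℝ => s ^ (-(1 / 2) : ℝ)) a continuousOn_id hf,
    ← cfc_mul (fun s : ℝ => s ^ (-(1 / 2) : ℝ)) (fun s : ℝ => s * s ^ (-(1 / 2) : ℝ)) a hf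
      (continuousOn_id.mul hf), ← cfc_one (R := ℝ) (a := a)]
  refine cfc_congr fun s hs => ?_
  have hs0 := hpos s hs
  rw [Pi.one_apply, mul_left_comm, ← Real.rpow_add hs0]
  norm_num
  rw [Real.rpow_neg_one, mul_inv_cancel₀ hs0.ne']

theorem continuousOn_cfc_rpow_neg_half {A α : Type*} [TopologicalSpace α] [NormedRing A]
    [StarRing A] [NormedAlgebra ℝ A] [CompleteSpace A] [ContinuousStar A]
    [IsometricContinuousFunctionalCalculus ℝ A IsSelfAdjoint] {a : α → A} {S : Set α}
    (ha : ContinuousOn a S) (hsa : ∀ x ∈ S, IsSelfAdjoint (a x)) {c : ℝ} (hc0 : 0 < c)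
    (hc : ∀ x ∈ S, ∀ t ∈ spectrum ℝ (a x), c ≤ t) :
    ContinuousOn (fun x => cfc (fun s : ℝ => s ^ (-(1 / 2) : ℝ)) (a x)) S := by
  refine ContinuousOn.cfc (s := fun x => Set.Icc c (‖a x‖ * ‖(1 : A)‖ + 1)) _
    (fun x _ => isCompact_Icc) ha (fun x hx => ?_) hsa
    (fun x _ => continuousOn_rpow_neg_half fun t ht => hc0.trans_le ht.1)
  have hnorm : ContinuousOn (fun x => ‖a x‖ * ‖(1 : A)‖) S := ha.norm.mul continuousOn_const
  filter_upwards [(hnorm x hx).eventually_lt continuousWithinAt_const (lt_add_one _),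
    self_mem_nhdsWithin] with y hy hyS t ht
  exact ⟨hc y hyS t ht, (le_abs_self t).trans ((spectrum.norm_le_norm_mul_of_mem ht).trans hy.le)⟩

variable {n : ℕ}

theorem toEuclideanLin_mul_apply (A B : Matrix (Fin n) (Fin n) ℝ) (z : E n) :
    Matrix.toEuclideanLin (A * B) z = Matrix.toEuclideanLin A (Matrix.toEuclideanLin B z) := by
  simp

theorem inner_toEuclideanLin_comm {A : Matrix (Fin n) (Fin n) ℝ} (hA : A.IsHermitian)
    (y z : E n) :
    inner ℝ (Matrix.toEuclideanLin A y) z = inner ℝ y (Matrix.toEuclideanLin A z) :=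
  Matrix.isSymmetric_toEuclideanLin_iff.2 hA y z

theorem continuousOn_toEuclideanLin_apply {α : Type*} [TopologicalSpace α] {S : Set α}
    {A : α → Matrix (Fin n) (Fin n) ℝ} {z : α → E n} (hA : ContinuousOn A S)
    (hz : ContinuousOn z S) : ContinuousOn (fun a => Matrix.toEuclideanLin (A a) (z a)) S :=
  ((PiLp.continuous_toLp 2 _).comp (continuous_fst.matrix_mulVec
    continuous_snd)).comp_continuousOn
    (hA.prodMk ((PiLp.continuous_ofLp 2 _).comp_continuousOn hz))

theorem le_of_mem_spectrum {M : Matrix (Fin n) (Fin n) ℝ} (hM : M.IsHermitian) {c : ℝ}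
    (hc : ∀ h : E n, c * ‖h‖ ^ 2 ≤ inner ℝ h (Matrix.toEuclideanLin M h)) {s : ℝ}
    (hs : s ∈ spectrum ℝ M) : c ≤ s := by
  rw [hM.spectrum_real_eq_range_eigenvalues] at hs
  obtain ⟨i, rfl⟩ := hs
  have heig : Matrix.toEuclideanLin M (hM.eigenvectorBasis i) =
      hM.eigenvalues i • hM.eigenvectorBasis i := by
    ext j
    simpa using congrFun (hM.mulVec_eigenvectorBasis i) j
  simpa [heig, inner_smul_right] using hc (hM.eigenvectorBasis i)

variable {X : Set (E n)} {ν : ℝ} {R : E n → ℝ}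

theorem hessian_apply (x : E n) (j k : Fin n) :
    hessian R x j k = fderiv ℝ (fderiv ℝ R) x (EuclideanSpace.single j 1)
      (EuclideanSpace.single k 1) := by
  simp [hessian, iteratedFDeriv_two_apply]

theorem inner_hessian (x h : E n) :
    inner ℝ h (Matrix.toEuclideanLin (hessian R x) h) = hessForm R x h := by
  have hcoord : h = ∑ j, h j • EuclideanSpace.single j (1 : ℝ) := by
    ext k
    simp [Finset.sum_apply, Pi.single_apply]
  have hsum : hessForm R x h = ∑ j, ∑ k, h j * (h k * hessian R x j k) := by
    rw [hessForm, iteratedFDeriv_two_apply]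
    simp only [Matrix.cons_val_zero, Matrix.cons_val_one, hessian_apply]
    conv_lhs => rw [hcoord]
    simp only [map_sum, sum_apply, map_smul, smul_apply, smul_eq_mul, Finset.mul_sum]
    exact Finset.sum_comm.trans
      (Finset.sum_congr rfl fun j _ => Finset.sum_congr rfl fun k _ => by ring)
  simp only [hsum, PiLp.inner_apply, Matrix.ofLp_toLpLin, Matrix.toLin'_apply, Matrix.mulVec,
    dotProduct, RCLike.inner_apply, conj_trivial, Finset.sum_mul]
  exact Finset.sum_congr rfl fun j _ => Finset.sum_congr rfl fun k _ => by ring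

theorem inner_hessian_add (c : ℝ) (x h : E n) :
    inner ℝ h (Matrix.toEuclideanLin (hessian R x + c • (1 : Matrix (Fin n) (Fin n) ℝ)) h) =
      hessForm R x h + c * ‖h‖ ^ 2 := by
  rw [map_add, LinearMap.add_apply, inner_add_right, inner_hessian, map_smul,
    Matrix.toLpLin_one, LinearMap.smul_apply, LinearMap.id_apply, inner_smul_right,
    real_inner_self_eq_norm_sq]

theorem isHermitian_scaling (R : E n → ℝ) (c : ℝ) (x : E n) : (scaling R c x).IsHermitian :=
  cfc_predicate _ _

theorem inner_inv_scaling (R : E n → ℝ) (c : ℝ) (x y z : E n) :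
    inner ℝ (Matrix.toEuclideanLin (scaling R c x)⁻¹ y) z =
      inner ℝ y (Matrix.toEuclideanLin (scaling R c x)⁻¹ z) :=
  inner_toEuclideanLin_comm (isHermitian_scaling R c x).inv y z

namespace IsSelfConcordantBarrier

theorem isHermitian_hessian (hb : IsSelfConcordantBarrier X ν R) {x : E n}
    (hx : x ∈ interior X) : (hessian R x).IsHermitian := by
  ext j k
  simp only [Matrix.conjTranspose_apply, hessian_apply, star_trivial]
  exact (hb.contDiffAt hx).isSymmSndFDerivAt (by simp; norm_num) _ _

theorem continuousOn_hessian (hb : IsSelfConcordantBarrier X ν R) :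
    ContinuousOn (hessian R) (interior X) := by
  have hsnd : ContinuousOn (iteratedFDeriv ℝ 2 R) (interior X) := fun x hx =>
    ((hb.contDiffAt hx).differentiableAt_iteratedFDeriv
      (by norm_num)).continuousAt.continuousWithinAt
  exact continuousOn_pi.2 fun j => continuousOn_pi.2 fun k =>
    (ContinuousMultilinearMap.apply ℝ (fun _ : Fin 2 => E n) ℝ _).continuous.comp_continuousOn hsnd

variable {c : ℝ}

theorem isHermitian_hessian_add (hb : IsSelfConcordantBarrier X ν R) {x : E n}
    (hx : x ∈ interior X) : (hessian R x + c • (1 : Matrix (Fin n) (Fin n) ℝ)).IsHermitian :=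
  (hb.isHermitian_hessian hx).add (by simp [Matrix.IsHermitian])

theorem le_of_mem_spectrum_hessian_add (hb : IsSelfConcordantBarrier X ν R) {x : E n}
    (hx : x ∈ interior X) {s : ℝ}
    (hs : s ∈ spectrum ℝ (hessian R x + c • (1 : Matrix (Fin n) (Fin n) ℝ))) : c ≤ s :=
  le_of_mem_spectrum (hb.isHermitian_hessian_add hx) (fun h => by
    rw [inner_hessian_add]
    exact le_add_of_nonneg_left (hb.hessForm_nonneg hx h)) hs

theorem scaling_mul_mul (hb : IsSelfConcordantBarrier X ν R) (hc : 0 < c) {x : E n}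
    (hx : x ∈ interior X) :
    scaling R c x * ((hessian R x + c • (1 : Matrix (Fin n) (Fin n) ℝ)) * scaling R c x) = 1 :=
  cfc_rpow_neg_half_mul_self_mul (hb.isHermitian_hessian_add hx).isSelfAdjoint
    fun _ ht => hc.trans_le (hb.le_of_mem_spectrum_hessian_add hx ht)

theorem isUnit_det_scaling (hb : IsSelfConcordantBarrier X ν R) (hc : 0 < c) {x : E n}
    (hx : x ∈ interior X) : IsUnit (scaling R c x).det :=
  Matrix.isUnit_det_of_right_inverse (hb.scaling_mul_mul hc hx)

theorem hessForm_scaling_add (hb : IsSelfConcordantBarrier X ν R) (hc : 0 < c) {x : E n}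
    (hx : x ∈ interior X) (z : E n) :
    hessForm R x (Matrix.toEuclideanLin (scaling R c x) z) +
      c * ‖Matrix.toEuclideanLin (scaling R c x) z‖ ^ 2 = ‖z‖ ^ 2 := by
  rw [← inner_hessian_add, inner_toEuclideanLin_comm (isHermitian_scaling R c x),
    ← toEuclideanLin_mul_apply, ← toEuclideanLin_mul_apply, Matrix.mul_assoc,
    hb.scaling_mul_mul hc hx, Matrix.toLpLin_one, LinearMap.id_apply, real_inner_self_eq_norm_sq]

theorem norm_scaling_sq_le (hb : IsSelfConcordantBarrier X ν R) (hc : 0 < c) {x : E n}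
    (hx : x ∈ interior X) (z : E n) :
    ‖Matrix.toEuclideanLin (scaling R c x) z‖ ^ 2 ≤ ‖z‖ ^ 2 / c := by
  rw [le_div_iff₀' hc, ← hb.hessForm_scaling_add hc hx z]
  exact le_add_of_nonneg_left (hb.hessForm_nonneg hx _)

theorem add_scaling_mem_interior (hb : IsSelfConcordantBarrier X ν R) (hc : 0 < c) {x : E n}
    (hx : x ∈ interior X) {z : E n} (hz : ‖z‖ = 1) :
    x + Matrix.toEuclideanLin (scaling R c x) z ∈ interior X := by
  rcases eq_or_ne (Matrix.toEuclideanLin (scaling R c x) z) 0 with h0 | h0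
  · rwa [h0, add_zero]
  · have hsum := hb.hessForm_scaling_add hc hx z
    rw [hz, one_pow] at hsum
    exact hb.add_mem_interior hx
      ((lt_add_of_pos_right _ (mul_pos hc (pow_pos (norm_pos_iff.2 h0) 2))).trans_eq hsum)

theorem scaling_inv_scaling (hb : IsSelfConcordantBarrier X ν R) (hc : 0 < c) {x : E n}
    (hx : x ∈ interior X) (h : E n) :
    Matrix.toEuclideanLin (scaling R c x) (Matrix.toEuclideanLin (scaling R c x)⁻¹ h) = h := by
  rw [← toEuclideanLin_mul_apply, Matrix.mul_nonsing_inv _ (hb.isUnit_det_scaling hc hx),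
    Matrix.toLpLin_one, LinearMap.id_apply]

theorem norm_inv_scaling_sq (hb : IsSelfConcordantBarrier X ν R) (hc : 0 < c) {x : E n}
    (hx : x ∈ interior X) (h : E n) :
    ‖Matrix.toEuclideanLin (scaling R c x)⁻¹ h‖ ^ 2 = hessForm R x h + c * ‖h‖ ^ 2 := by
  rw [← hb.hessForm_scaling_add hc hx, hb.scaling_inv_scaling hc hx]

open scoped Matrix.Norms.L2Operator in
theorem continuousOn_scaling (hb : IsSelfConcordantBarrier X ν R) (hc : 0 < c) :
    ContinuousOn (scaling R c) (interior X) :=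
  continuousOn_cfc_rpow_neg_half (hb.continuousOn_hessian.add continuousOn_const)
    (fun _ hx => (hb.isHermitian_hessian_add hx).isSelfAdjoint) hc
    (fun _ hx _ ht => hb.le_of_mem_spectrum_hessian_add hx ht)

theorem continuousOn_inv_scaling (hb : IsSelfConcordantBarrier X ν R) (hc : 0 < c) :
    ContinuousOn (fun x => (scaling R c x)⁻¹) (interior X) := by
  have hscaling := hb.continuousOn_scaling hc
  simp only [Matrix.inv_def, Ring.inverse_eq_inv']
  exact (((continuous_id.matrix_det).comp_continuousOn hscaling).inv₀
    fun x hx => (hb.isUnit_det_scaling hc hx).ne_zero).smul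
      ((continuous_id.matrix_adjugate).comp_continuousOn hscaling)

end IsSelfConcordantBarrier

end Scaling

/-! ### Uniform directions -/

section Sphere

variable {n : ℕ}

/-- The action of a linear isometry on the unit sphere; the symmetries of the uniform distribution
are expressed through it. -/
def sphereMap (f : E n ≃ₗᵢ[ℝ] E n) (z : Metric.sphere (0 : E n) 1) : Metric.sphere (0 : E n) 1 :=
  ⟨f z, by simp⟩

theorem measurable_sphereMap (f : E n ≃ₗᵢ[ℝ] E n) : Measurable (sphereMap f) :=
  (f.continuous.measurable.comp measurable_subtype_coe).subtype_mk

theorem sphereMap_sphereMap_symm (f : E n ≃ₗᵢ[ℝ] E n) (z : Metric.sphere (0 : E n) 1) :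
    sphereMap f (sphereMap f.symm z) = z :=
  Subtype.ext (f.apply_symm_apply z)

open scoped Pointwise in
theorem Ioo_smul_image_preimage_sphereMap (f : E n ≃ₗᵢ[ℝ] E n)
    (s : Set (Metric.sphere (0 : E n) 1)) :
    Set.Ioo (0 : ℝ) 1 • ((↑) '' (sphereMap f ⁻¹' s) : Set (E n)) =
      f ⁻¹' (Set.Ioo (0 : ℝ) 1 • ((↑) '' s)) := by
  ext x
  simp only [Set.mem_smul, Set.mem_image, Set.mem_preimage]
  constructor
  · rintro ⟨r, hr, _, ⟨z, hz, rfl⟩, rfl⟩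
    exact ⟨r, hr, _, ⟨sphereMap f z, hz, rfl⟩, (f.map_smul r _).symm⟩
  · rintro ⟨r, hr, _, ⟨z, hz, rfl⟩, hx⟩
    refine ⟨r, hr, _, ⟨sphereMap f.symm z, by rwa [sphereMap_sphereMap_symm], rfl⟩, ?_⟩
    exact f.injective (by simp [sphereMap, hx])

theorem measurePreserving_sphereMap (f : E n ≃ₗᵢ[ℝ] E n) :
    MeasurePreserving (sphereMap f) (sphereUniform n) (sphereUniform n) := by
  refine ⟨measurable_sphereMap f, ?_⟩
  rw [sphereUniform, Measure.map_smul]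
  congr 1
  ext s hs
  rw [Measure.map_apply (measurable_sphereMap f) hs, Measure.toSphere_apply' _ hs,
    Measure.toSphere_apply' _ (measurable_sphereMap f hs), Ioo_smul_image_preimage_sphereMap]
  congr 1
  exact f.measurePreserving.measure_preimage_equiv (f := f.toHomeomorph.toMeasurableEquiv) _

theorem isProbabilityMeasure_sphereUniform (hn : 1 ≤ n) :
    IsProbabilityMeasure (sphereUniform n) := by
  have : NeZero n := ⟨Nat.one_le_iff_ne_zero.1 hn⟩
  exact ⟨ENNReal.inv_mul_cancel (Measure.measure_univ_ne_zero.2 (Measure.toSphere_ne_zero _))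
    (measure_ne_top _ _)⟩

theorem integral_inner_sq_eq_of_norm_eq {p q : E n} (hpq : ‖p‖ = ‖q‖) :
    ∫ z, inner ℝ (z : E n) p ^ 2 ∂sphereUniform n =
      ∫ z, inner ℝ (z : E n) q ^ 2 ∂sphereUniform n := by
  let f := (Submodule.span ℝ {p - q})ᗮ.reflection
  have hf : f p = q := Submodule.reflection_sub hpq
  have hinv := (measurePreserving_sphereMap f).hasLaw.integral_comp
    (f := fun z => inner ℝ (z : E n) q ^ 2) (Continuous.aestronglyMeasurable (by fun_prop))
  simpa [sphereMap, ← hf] using hinv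

theorem integrable_inner_sq (hn : 1 ≤ n) (q : E n) :
    Integrable (fun z : Metric.sphere (0 : E n) 1 => inner ℝ (z : E n) q ^ 2)
      (sphereUniform n) := by
  have := isProbabilityMeasure_sphereUniform hn
  refine Integrable.of_bound (C := ‖q‖ ^ 2)
    (Continuous.aestronglyMeasurable (by fun_prop)) (Filter.Eventually.of_forall fun z => ?_)
  rw [norm_pow, Real.norm_eq_abs]
  gcongr
  simpa using abs_real_inner_le_norm (z : E n) q

/- By symmetry the second moment in every direction is the same as in the directions of an
orthonormal basis, along which the squares add up to one. -/
theorem integral_inner_sq (hn : 1 ≤ n) (q : E n) :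
    ∫ z, inner ℝ (z : E n) q ^ 2 ∂sphereUniform n = ‖q‖ ^ 2 / n := by
  have := isProbabilityMeasure_sphereUniform hn
  have hsym : ∀ j : Fin n, ∫ z, inner ℝ (z : E n) q ^ 2 ∂sphereUniform n =
      ∫ z, inner ℝ (z : E n) (‖q‖ • EuclideanSpace.single j (1 : ℝ)) ^ 2 ∂sphereUniform n :=
    fun j => integral_inner_sq_eq_of_norm_eq (by simp [norm_smul])
  have hsum : ∀ z : Metric.sphere (0 : E n) 1,
      ∑ j : Fin n, inner ℝ (z : E n) (‖q‖ • EuclideanSpace.single j (1 : ℝ)) ^ 2 = ‖q‖ ^ 2 := by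
    intro z
    have hz : ∑ j, (z : E n) j ^ 2 = 1 := by
      rw [← EuclideanSpace.real_norm_sq_eq, norm_eq_of_mem_sphere, one_pow]
    simp [inner_smul_right, EuclideanSpace.inner_single_right, mul_pow, ← Finset.mul_sum, hz]
  have hconst : ∑ _j : Fin n, ∫ z, inner ℝ (z : E n) q ^ 2 ∂sphereUniform n = ‖q‖ ^ 2 := by
    rw [Finset.sum_congr rfl fun j _ => hsym j,
      ← integral_finsetSum _ fun j _ => integrable_inner_sq hn _]
    simp [hsum]
  rw [Finset.sum_const, Finset.card_univ, Fintype.card_fin, nsmul_eq_mul] at hconst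
  rw [eq_div_iff (by positivity), mul_comm, hconst]

theorem reflection_orthogonal_singleton_apply {F : Type*} [NormedAddCommGroup F]
    [InnerProductSpace ℝ F] (q z : F) :
    (Submodule.span ℝ {q})ᗮ.reflection z = z - (2 * inner ℝ z q / ‖q‖ ^ 2) • q := by
  rw [Submodule.reflection_orthogonal_apply, Submodule.reflection_singleton_apply,
    real_inner_comm]
  simp only [RCLike.ofReal_real_eq_id, id]
  module

end Sphere

/-! ### Joint actions and joint directions -/

section Game

variable {N : ℕ} {d : Fin N → ℕ}

namespace SmoothConcaveGame

variable {G : SmoothConcaveGame N d}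

/-- Joint actions all of whose components are interior: the range of the pivots. -/
def interiorActions (G : SmoothConcaveGame N d) : Set (Profile d) :=
  Set.univ.pi fun i => interior (G.X i)

/-- The individual payoff gradients are Lipschitz with the common constant `ℓ`, for the Euclidean
distance of joint actions. -/
def GradLipschitzWith (G : SmoothConcaveGame N d) (ℓ : NNReal) : Prop :=
  ∀ i, ∀ x ∈ G.actions, ∀ x' ∈ G.actions, ‖G.v i x - G.v i x'‖ ≤ ℓ * √(sqDist x x')

/-- An upper bound for the Euclidean diameters of all action sets. -/
def diameter (G : SmoothConcaveGame N d) : ℝ := ∑ i, Metric.diam (G.X i)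

theorem mem_interiorActions {x : Profile d} :
    x ∈ G.interiorActions ↔ ∀ i, x i ∈ interior (G.X i) :=
  Set.mem_univ_pi

theorem mem_actions {x : Profile d} : x ∈ G.actions ↔ ∀ i, x i ∈ G.X i :=
  Set.mem_univ_pi

theorem interiorActions_subset : G.interiorActions ⊆ G.actions :=
  Set.pi_mono fun _ _ => interior_subset

theorem diameter_nonneg (G : SmoothConcaveGame N d) : 0 ≤ G.diameter :=
  Finset.sum_nonneg fun _ _ => Metric.diam_nonneg

theorem norm_sub_le_diameter {i : Fin N} {x y : E (d i)} (hx : x ∈ G.X i) (hy : y ∈ G.X i) :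
    ‖x - y‖ ≤ G.diameter := by
  rw [← dist_eq_norm]
  exact (Metric.dist_le_diam_of_mem (G.compact_X i).isBounded hx hy).trans
    (Finset.single_le_sum (f := fun i => Metric.diam (G.X i))
      (fun _ _ => Metric.diam_nonneg) (Finset.mem_univ i))

theorem update_mem_actions {x : Profile d} (hx : x ∈ G.actions) {i : Fin N} {y : E (d i)}
    (hy : y ∈ G.X i) : Function.update x i y ∈ G.actions :=
  Set.update_mem_pi_iff_of_mem hx |>.2 fun _ => hy

theorem v_update (i : Fin N) (x : Profile d) (y : E (d i)) :
    G.v i (Function.update x i y) =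
      gradientWithin (fun y' => G.u i (Function.update x i y')) (G.X i) y := by
  simp [v, payoffGrad]

theorem hasFDerivWithinAt_u_update {i : Fin N} {x : Profile d} (hx : x ∈ G.actions) {y : E (d i)}
    (hy : y ∈ G.X i) :
    HasFDerivWithinAt (fun y' => G.u i (Function.update x i y'))
      (InnerProductSpace.toDual ℝ (E (d i)) (G.v i (Function.update x i y))) (G.X i) y := by
  rw [v_update, toDual_gradientWithin]
  exact (G.differentiableOn_u i x hx y hy).hasFDerivWithinAt

theorem exists_gradLipschitzWith (G : SmoothConcaveGame N d) : ∃ ℓ, G.GradLipschitzWith ℓ := by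
  choose ℓ hℓ using G.lipschitz_grad
  refine ⟨∑ i, (ℓ i).toNNReal, fun i x hx x' hx' => (hℓ i x hx x' hx').trans ?_⟩
  have hle : (ℓ i).toNNReal ≤ ∑ i, (ℓ i).toNNReal :=
    Finset.single_le_sum (f := fun i => (ℓ i).toNNReal) (fun _ _ => zero_le)
      (Finset.mem_univ i)
  gcongr
  exact (Real.le_coe_toNNReal _).trans (NNReal.coe_le_coe.2 hle)

theorem abs_u_sub_update_sub_le {ℓ : NNReal} (hℓ : G.GradLipschitzWith ℓ) {i : Fin N}
    {x y : Profile d} (hx : x ∈ G.actions) (hy : y ∈ G.actions) {a : E (d i)} (ha : a ∈ G.X i)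
    {r : Fin N → ℝ} (hr : ∀ j, ‖y j - x j‖ ^ 2 ≤ r j) (har : ‖a - x i‖ ^ 2 ≤ r i) :
    |G.u i y - G.u i (Function.update y i a) - inner ℝ (G.v i x) (y i - a)| ≤
      ℓ * √(∑ j, r j) * ‖y i - a‖ := by
  have hball {b : E (d i)} : b ∈ Metric.closedBall (x i) √(r i) ↔ ‖b - x i‖ ^ 2 ≤ r i := by
    rw [mem_closedBall_iff_norm, Real.le_sqrt (norm_nonneg _) ((sq_nonneg _).trans har)]
  have hexpand := ((G.convex_X i).inter (convex_closedBall (x i) √(r i))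
    ).norm_image_sub_le_of_norm_hasFDerivWithin_le' (𝕜 := ℝ)
    (f := fun b => G.u i (Function.update y i b))
    (f' := fun b => InnerProductSpace.toDual ℝ (E (d i)) (G.v i (Function.update y i b)))
    (φ := InnerProductSpace.toDual ℝ (E (d i)) (G.v i x))
    (C := ℓ * √(∑ j, r j)) (x := a) (y := y i)
    (fun b hb => (hasFDerivWithinAt_u_update hy hb.1).mono Set.inter_subset_left) ?_
    ⟨ha, hball.2 har⟩ ⟨mem_actions.1 hy i, hball.2 (hr i)⟩
  · simpa using hexpand
  · intro b hb
    rw [← map_sub, LinearIsometryEquiv.norm_map]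
    refine (hℓ i _ (update_mem_actions hy hb.1) x hx).trans ?_
    gcongr
    refine Finset.sum_le_sum fun j _ => ?_
    rcases eq_or_ne j i with rfl | hj
    · simpa using hball.1 hb.2
    · simpa [hj] using hr j

end SmoothConcaveGame

/-- Joint perturbation directions: one point of the unit sphere for every player. -/
abbrev Directions (d : Fin N → ℕ) : Type := (i : Fin N) → Metric.sphere (0 : E (d i)) 1

namespace Directions

/-- Joint directions regarded as vectors, the form in which the algorithm uses them. -/
def toProfile (z : Directions d) : Profile d := fun i => z i

theorem continuous_toProfile : Continuous (toProfile : Directions d → Profile d) :=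
  continuous_pi fun i => continuous_subtype_val.comp (continuous_apply i)

theorem norm_toProfile (z : Directions d) (i : Fin N) : ‖z.toProfile i‖ = 1 :=
  norm_eq_of_mem_sphere _

theorem toProfile_update (z : Directions d) (i : Fin N) (w : Metric.sphere (0 : E (d i)) 1) :
    toProfile (Function.update z i w) = Function.update z.toProfile i w := by
  funext j
  rcases eq_or_ne j i with rfl | hj
  · simp [toProfile]
  · simp [toProfile, hj]

/-- Reflects the direction of player `i` in the hyperplane orthogonal to `q`. -/
def reflect (i : Fin N) (q : E (d i)) (z : Directions d) : Directions d :=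
  Function.update z i (sphereMap (Submodule.span ℝ {q})ᗮ.reflection (z i))

theorem coe_reflect_apply (i : Fin N) (q : E (d i)) (z : Directions d) :
    (reflect i q z i : E (d i)) =
      (z i : E (d i)) - (2 * inner ℝ (z i : E (d i)) q / ‖q‖ ^ 2) • q := by
  rw [reflect, Function.update_self]
  exact reflection_orthogonal_singleton_apply q (z i)

theorem inner_reflect_apply (i : Fin N) (q : E (d i)) (z : Directions d) :
    inner ℝ (reflect i q z i : E (d i)) q = -inner ℝ (z i : E (d i)) q := by
  rcases eq_or_ne q 0 with rfl | hq
  · simp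
  have hq : ‖q‖ ≠ 0 := norm_ne_zero_iff.2 hq
  rw [coe_reflect_apply, inner_sub_left, real_inner_smul_left, real_inner_self_eq_norm_sq]
  field_simp
  ring

theorem continuous_reflect (i : Fin N) (q : E (d i)) : Continuous (reflect i q) :=
  continuous_id.update i <| Continuous.subtype_mk
    ((Submodule.reflection _).continuous.comp
      (continuous_subtype_val.comp (continuous_apply i))) _

end Directions

/-- The law of the directions of one round: independent uniform directions of the players. -/
def directionLaw (d : Fin N → ℕ) : Measure (Directions d) :=
  Measure.pi fun i => sphereUniform (d i)

theorem isProbabilityMeasure_directionLaw (hd : ∀ i, 1 ≤ d i) :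
    IsProbabilityMeasure (directionLaw d) := by
  have := fun i => isProbabilityMeasure_sphereUniform (hd i)
  unfold directionLaw
  infer_instance

theorem integrable_directionLaw_of_continuous (hd : ∀ i, 1 ≤ d i) {f : Directions d → ℝ}
    (hf : Continuous f) : Integrable f (directionLaw d) := by
  have := isProbabilityMeasure_directionLaw hd
  exact hf.integrable_of_hasCompactSupport (HasCompactSupport.of_compactSpace f)

theorem integral_inner_sq_directionLaw (hd : ∀ i, 1 ≤ d i) (i : Fin N) (q : E (d i)) :
    ∫ z, inner ℝ (z i : E (d i)) q ^ 2 ∂directionLaw d = ‖q‖ ^ 2 / d i := by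
  have := fun i => isProbabilityMeasure_sphereUniform (hd i)
  rw [← integral_inner_sq (hd i)]
  exact (measurePreserving_eval (fun i => sphereUniform (d i)) i).hasLaw.integral_comp
    (f := fun z => inner ℝ (z : E (d i)) q ^ 2) (Continuous.aestronglyMeasurable (by fun_prop))

theorem measurePreserving_reflect (hd : ∀ i, 1 ≤ d i) (i : Fin N) (q : E (d i)) :
    MeasurePreserving (Directions.reflect i q) (directionLaw d) (directionLaw d) := by
  have := fun i => isProbabilityMeasure_sphereUniform (hd i)
  let f : (j : Fin N) → E (d j) ≃ₗᵢ[ℝ] E (d j) :=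
    Function.update (fun j => LinearIsometryEquiv.refl ℝ (E (d j))) i
      (Submodule.span ℝ {q})ᗮ.reflection
  have hf : Directions.reflect i q = fun z j => sphereMap (f j) (z j) := by
    funext z j
    rcases eq_or_ne j i with rfl | hj
    · simp [Directions.reflect, f]
    · ext1
      simp [Directions.reflect, sphereMap, f, hj]
  rw [hf]
  exact measurePreserving_pi _ _ fun j => measurePreserving_sphereMap (f j)

theorem integral_eq_integral_add_comp_div_two {α : Type*} [MeasurableSpace α] {μ : Measure α}
    {ρ : α → α} (hρ : MeasurePreserving ρ μ μ) {f : α → ℝ} (hf : Integrable f μ) :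
    ∫ a, f a ∂μ = ∫ a, (f a + f (ρ a)) / 2 ∂μ := by
  have hcomp : ∫ a, f (ρ a) ∂μ = ∫ a, f a ∂μ :=
    hρ.hasLaw.integral_comp hf.aestronglyMeasurable
  have hρf : Integrable (fun a => f (ρ a)) μ := hρ.integrable_comp_of_integrable hf
  rw [integral_div, integral_add hf hρf, hcomp, add_self_div_two]

end Game

/-! ### One round -/

section Round

variable {N : ℕ} {d : Fin N → ℕ} {G : SmoothConcaveGame N d} {R : (i : Fin N) → E (d i) → ℝ}
  {ν : Fin N → ℝ} {lam : Fin N → ℝ} {β : ℝ} {η : ℕ → ℝ} {t : ℕ}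

/-- The pairs of a pivot and joint directions that can occur in a round; the quantities computed
in a round are continuous there. -/
def roundDomain (G : SmoothConcaveGame N d) : Set (Profile d × Profile d) :=
  {p | p.1 ∈ G.interiorActions ∧ ∀ i, ‖p.2 i‖ = 1}

/-- The pivot of round `t + 1`, for the pivot `x` and the directions `z` of round `t`. -/
def nextPivot (G : SmoothConcaveGame N d) (R : (i : Fin N) → E (d i) → ℝ) (lam : Fin N → ℝ)
    (β : ℝ) (η : ℕ → ℝ) (t : ℕ) (x z : Profile d) : Profile d := fun i =>
  prox (G.X i) (R i) (η t) (coeff lam β η t i) (x i) (gradEst G R lam β η t x z i)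

theorem mem_roundDomain {x : Profile d} (hx : x ∈ G.interiorActions) (z : Directions d) :
    (x, z.toProfile) ∈ roundDomain G :=
  ⟨hx, z.norm_toProfile⟩

theorem play_mem_interiorActions (hR : ∀ i, IsSelfConcordantBarrier (G.X i) (ν i) (R i))
    (hc : ∀ i, 0 < coeff lam β η t i) {x z : Profile d} (hx : x ∈ G.interiorActions)
    (hz : ∀ i, ‖z i‖ = 1) : play R lam β η t x z ∈ G.interiorActions := by
  rw [SmoothConcaveGame.mem_interiorActions] at *
  exact fun i => (hR i).add_scaling_mem_interior (hc i) (hx i) (hz i)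

theorem norm_play_sub_sq_le (hR : ∀ i, IsSelfConcordantBarrier (G.X i) (ν i) (R i))
    (hc : ∀ i, 0 < coeff lam β η t i) {x z : Profile d} (hx : x ∈ G.interiorActions)
    (hz : ∀ i, ‖z i‖ = 1) (i : Fin N) :
    ‖play R lam β η t x z i - x i‖ ^ 2 ≤ 1 / coeff lam β η t i := by
  have hle := (hR i).norm_scaling_sq_le (hc i) (SmoothConcaveGame.mem_interiorActions.1 hx i) (z i)
  rw [hz, one_pow] at hle
  simpa [play, scalingAt] using hle

theorem play_update (x z : Profile d) (i : Fin N) (w : E (d i)) :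
    play R lam β η t x (Function.update z i w) = Function.update (play R lam β η t x z) i
      (x i + Matrix.toEuclideanLin (scalingAt R lam β η t x i) w) := by
  funext j
  rcases eq_or_ne j i with rfl | hj
  · simp [play]
  · simp [play, hj]

theorem continuousOn_fst_roundDomain (i : Fin N) :
    ContinuousOn (fun p : Profile d × Profile d => p.1 i) (roundDomain G) :=
  ((continuous_apply i).comp continuous_fst).continuousOn

theorem continuousOn_snd_roundDomain (i : Fin N) :
    ContinuousOn (fun p : Profile d × Profile d => p.2 i) (roundDomain G) :=
  ((continuous_apply i).comp continuous_snd).continuousOn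

theorem continuousOn_play (hR : ∀ i, IsSelfConcordantBarrier (G.X i) (ν i) (R i))
    (hc : ∀ i, 0 < coeff lam β η t i) :
    ContinuousOn (fun p : Profile d × Profile d => play R lam β η t p.1 p.2) (roundDomain G) :=
  continuousOn_pi.2 fun i => (continuousOn_fst_roundDomain i).add <|
    continuousOn_toEuclideanLin_apply
      (((hR i).continuousOn_scaling (hc i)).comp (continuousOn_fst_roundDomain i)
        fun _ hp => SmoothConcaveGame.mem_interiorActions.1 hp.1 i)
      (continuousOn_snd_roundDomain i)

theorem continuousOn_gradEst (hR : ∀ i, IsSelfConcordantBarrier (G.X i) (ν i) (R i))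
    (hc : ∀ i, 0 < coeff lam β η t i) (i : Fin N) :
    ContinuousOn (fun p : Profile d × Profile d => gradEst G R lam β η t p.1 p.2 i)
      (roundDomain G) := by
  have hpayoff : ContinuousOn (fun p : Profile d × Profile d =>
      G.u i (play R lam β η t p.1 p.2)) (roundDomain G) :=
    (G.continuousOn_u i).comp (continuousOn_play hR hc) fun _ hp =>
      SmoothConcaveGame.interiorActions_subset (play_mem_interiorActions hR hc hp.1 hp.2)
  exact (continuousOn_const.mul hpayoff).smul <| continuousOn_toEuclideanLin_apply
    (((hR i).continuousOn_inv_scaling (hc i)).comp (continuousOn_fst_roundDomain i)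
      fun _ hp => SmoothConcaveGame.mem_interiorActions.1 hp.1 i)
    (continuousOn_snd_roundDomain i)

theorem continuous_inner_gradEst (hR : ∀ i, IsSelfConcordantBarrier (G.X i) (ν i) (R i))
    (hc : ∀ i, 0 < coeff lam β η t i) {x : Profile d} (hx : x ∈ G.interiorActions) (i : Fin N)
    (h : E (d i)) :
    Continuous fun z : Directions d => inner ℝ (gradEst G R lam β η t x z.toProfile i) h :=
  ((continuousOn_gradEst hR hc i).comp_continuous
    (continuous_const.prodMk Directions.continuous_toProfile) (mem_roundDomain hx)).inner
      continuous_const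

theorem inner_gradEst (x z : Profile d) (i : Fin N) (h : E (d i)) :
    inner ℝ (gradEst G R lam β η t x z i) h = d i * G.u i (play R lam β η t x z) *
      inner ℝ (z i) (Matrix.toEuclideanLin (scalingAt R lam β η t x i)⁻¹ h) := by
  rw [gradEst, real_inner_smul_left, scalingAt, inner_inv_scaling]

theorem play_reflect (x : Profile d) (i : Fin N) (q : E (d i)) (z : Directions d) :
    play R lam β η t x (z.reflect i q).toProfile =
      Function.update (play R lam β η t x z.toProfile) i
        (play R lam β η t x (z.reflect i q).toProfile i) := by
  rw [Directions.reflect, Directions.toProfile_update, play_update, Function.update_self]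

theorem play_sub_play_reflect (x : Profile d) (i : Fin N) (q : E (d i)) (z : Directions d) :
    play R lam β η t x z.toProfile i - play R lam β η t x (z.reflect i q).toProfile i =
      (2 * inner ℝ (z i : E (d i)) q / ‖q‖ ^ 2) •
        Matrix.toEuclideanLin (scalingAt R lam β η t x i) q := by
  simp only [play, Directions.toProfile, Directions.coe_reflect_apply, map_sub, map_smul]
  module

/- The reflection moves the action of player `i` by a multiple of `h` only, and flips the sign of
`⟨z_i, q⟩`: two mirrored one-point estimates combine into a two-point estimate. -/
theorem abs_inner_gradEst_add_reflect_sub_le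
    (hR : ∀ i, IsSelfConcordantBarrier (G.X i) (ν i) (R i)) (hc : ∀ i, 0 < coeff lam β η t i)
    {ℓ : NNReal} (hℓ : G.GradLipschitzWith ℓ) {x : Profile d} (hx : x ∈ G.interiorActions)
    {i : Fin N} {q h : E (d i)} (hq : Matrix.toEuclideanLin (scalingAt R lam β η t x i)⁻¹ h = q)
    (z : Directions d) :
    |(inner ℝ (gradEst G R lam β η t x z.toProfile i) h +
        inner ℝ (gradEst G R lam β η t x (z.reflect i q).toProfile i) h) / 2 -
        d i * inner ℝ (G.v i x) h / ‖q‖ ^ 2 * inner ℝ (z i : E (d i)) q ^ 2| ≤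
      d i * (ℓ * √(∑ j, 1 / coeff lam β η t j) * ‖h‖) / ‖q‖ ^ 2 *
        inner ℝ (z i : E (d i)) q ^ 2 := by
  have hAq : Matrix.toEuclideanLin (scalingAt R lam β η t x i) q = h :=
    hq ▸ (hR i).scaling_inv_scaling (hc i) (SmoothConcaveGame.mem_interiorActions.1 hx i) h
  set s := inner ℝ (z i : E (d i)) q
  set y := play R lam β η t x z.toProfile
  set y' := play R lam β η t x (z.reflect i q).toProfile
  have hest : inner ℝ (gradEst G R lam β η t x z.toProfile i) h = d i * G.u i y * s := by
    rw [inner_gradEst, hq]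
    rfl
  have hest' : inner ℝ (gradEst G R lam β η t x (z.reflect i q).toProfile i) h =
      d i * G.u i y' * -s := by
    rw [inner_gradEst, hq, ← Directions.inner_reflect_apply]
    rfl
  have hexpand := SmoothConcaveGame.abs_u_sub_update_sub_le hℓ
    (SmoothConcaveGame.interiorActions_subset hx)
    (SmoothConcaveGame.interiorActions_subset
      (play_mem_interiorActions hR hc hx z.norm_toProfile))
    (SmoothConcaveGame.mem_actions.1 (SmoothConcaveGame.interiorActions_subset
      (play_mem_interiorActions hR hc hx (z.reflect i q).norm_toProfile)) i)
    (norm_play_sub_sq_le hR hc hx z.norm_toProfile)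
    (norm_play_sub_sq_le hR hc hx (z.reflect i q).norm_toProfile i)
  rw [← play_reflect, play_sub_play_reflect, hAq, real_inner_smul_right, norm_smul, norm_div,
    norm_mul, norm_pow, norm_norm, Real.norm_ofNat, Real.norm_eq_abs] at hexpand
  calc _ = |d i / 2 * s * (G.u i y - G.u i y' - 2 * s / ‖q‖ ^ 2 * inner ℝ (G.v i x) h)| := by
        rw [hest, hest']
        congr 1
        ring
    _ = d i / 2 * |s| * |G.u i y - G.u i y' - 2 * s / ‖q‖ ^ 2 * inner ℝ (G.v i x) h| := by
        rw [abs_mul, abs_mul, abs_of_nonneg (by positivity : (0 : ℝ) ≤ d i / 2)]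
    _ ≤ d i / 2 * |s| *
        (ℓ * √(∑ j, 1 / coeff lam β η t j) * (2 * |s| / ‖q‖ ^ 2 * ‖h‖)) := by gcongr
    _ = _ := by
        rw [← sq_abs s]
        ring

theorem abs_integral_inner_gradEst_sub_le (hd : ∀ i, 1 ≤ d i)
    (hR : ∀ i, IsSelfConcordantBarrier (G.X i) (ν i) (R i)) (hc : ∀ i, 0 < coeff lam β η t i)
    {ℓ : NNReal} (hℓ : G.GradLipschitzWith ℓ) {x : Profile d} (hx : x ∈ G.interiorActions)
    (i : Fin N) (h : E (d i)) :
    |∫ z, inner ℝ (gradEst G R lam β η t x z.toProfile i) h ∂directionLaw d -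
      inner ℝ (G.v i x) h| ≤ ℓ * √(∑ j, 1 / coeff lam β η t j) * ‖h‖ := by
  rcases eq_or_ne h 0 with rfl | h0
  · simp
  set F := fun z : Directions d => inner ℝ (gradEst G R lam β η t x z.toProfile i) h
  obtain ⟨q, hq⟩ : ∃ q, Matrix.toEuclideanLin (scalingAt R lam β η t x i)⁻¹ h = q := ⟨_, rfl⟩
  have hq0 : ‖q‖ ≠ 0 := by
    rintro hzero
    refine h0 ?_
    rw [← (hR i).scaling_inv_scaling (hc i) (SmoothConcaveGame.mem_interiorActions.1 hx i) h]
    change Matrix.toEuclideanLin _ (Matrix.toEuclideanLin (scalingAt R lam β η t x i)⁻¹ h) = 0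
    rw [hq, norm_eq_zero.1 hzero, map_zero]
  have hFcont : Continuous F := continuous_inner_gradEst hR hc hx i h
  have hFint := integrable_directionLaw_of_continuous hd hFcont
  have hsymmInt : Integrable (fun z => (F z + F (z.reflect i q)) / 2) (directionLaw d) :=
    integrable_directionLaw_of_continuous hd
      ((hFcont.add (hFcont.comp (Directions.continuous_reflect i q))).div_const 2)
  have hsqInt (a : ℝ) : Integrable (fun z : Directions d =>
      d i * a / ‖q‖ ^ 2 * inner ℝ (z i : E (d i)) q ^ 2) (directionLaw d) :=
    integrable_directionLaw_of_continuous hd (by fun_prop)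
  have hdi : (d i : ℝ) ≠ 0 := Nat.cast_ne_zero.2 (Nat.one_le_iff_ne_zero.1 (hd i))
  have hsq (a : ℝ) :
      ∫ z, d i * a / ‖q‖ ^ 2 * inner ℝ (z i : E (d i)) q ^ 2 ∂directionLaw d = a := by
    rw [integral_const_mul, integral_inner_sq_directionLaw hd]
    field_simp
  rw [integral_eq_integral_add_comp_div_two (measurePreserving_reflect hd i q) hFint,
    ← hsq (inner ℝ (G.v i x) h), ← integral_sub hsymmInt (hsqInt _),
    ← hsq (ℓ * √(∑ j, 1 / coeff lam β η t j) * ‖h‖)]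
  exact abs_integral_le_integral_abs.trans
    (integral_mono (hsymmInt.sub (hsqInt _)).abs (hsqInt _)
      (abs_inner_gradEst_add_reflect_sub_le hR hc hℓ hx hq))

theorem nextPivot_mem_interiorActions (hR : ∀ i, IsSelfConcordantBarrier (G.X i) (ν i) (R i))
    {x : Profile d} (hx : x ∈ G.interiorActions) (z : Profile d) :
    nextPivot G R lam β η t x z ∈ G.interiorActions := by
  rw [SmoothConcaveGame.mem_interiorActions] at *
  exact fun i => ((hR i).prox_spec (G.compact_X i) _ _ (hx i) _).1

theorem continuousOn_nextPivot (hR : ∀ i, IsSelfConcordantBarrier (G.X i) (ν i) (R i))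
    (hc : ∀ i, 0 < coeff lam β η t i) :
    ContinuousOn (fun p : Profile d × Profile d => nextPivot G R lam β η t p.1 p.2)
      (roundDomain G) :=
  continuousOn_pi.2 fun i => (hR i).continuousOn_prox (G.compact_X i) (G.convex_X i) (hc i)
    (continuousOn_fst_roundDomain i) (continuousOn_gradEst hR hc i)
    fun _ hp => SmoothConcaveGame.mem_interiorActions.1 hp.1 i

theorem continuous_nextPivot (hR : ∀ i, IsSelfConcordantBarrier (G.X i) (ν i) (R i))
    (hc : ∀ i, 0 < coeff lam β η t i) {x : Profile d} (hx : x ∈ G.interiorActions) :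
    Continuous fun z : Directions d => nextPivot G R lam β η t x z.toProfile :=
  (continuousOn_nextPivot hR hc).comp_continuous (f := fun z : Directions d => (x, z.toProfile))
    (continuous_const.prodMk Directions.continuous_toProfile) (mem_roundDomain hx)

theorem inner_gradEst_le (hR : ∀ i, IsSelfConcordantBarrier (G.X i) (ν i) (R i))
    (hc : ∀ i, 0 < coeff lam β η t i) {L : ℝ} (hL : ∀ i, ∀ x ∈ G.actions, |G.u i x| ≤ L)
    {x z : Profile d} (hx : x ∈ G.interiorActions) (hz : ∀ i, ‖z i‖ = 1) (i : Fin N)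
    (h : E (d i)) :
    inner ℝ (gradEst G R lam β η t x z i) h ≤
      d i * L * √(hessForm (R i) (x i) h + coeff lam β η t i * ‖h‖ ^ 2) := by
  rw [inner_gradEst, ← (hR i).norm_inv_scaling_sq (hc i)
    (SmoothConcaveGame.mem_interiorActions.1 hx i), Real.sqrt_sq (norm_nonneg _), mul_assoc,
    mul_assoc]
  refine mul_le_mul_of_nonneg_left ((le_abs_self _).trans ?_) (Nat.cast_nonneg _)
  have hu := hL i _ (SmoothConcaveGame.interiorActions_subset
    (play_mem_interiorActions hR hc hx hz))
  have hinner := abs_real_inner_le_norm (z i)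
    (Matrix.toEuclideanLin (scalingAt R lam β η t x i)⁻¹ h)
  rw [hz, one_mul] at hinner
  rw [abs_mul]
  exact mul_le_mul hu hinner (abs_nonneg _) ((abs_nonneg _).trans hu)

theorem bregman_nextPivot_add_sq_le (hR : ∀ i, IsSelfConcordantBarrier (G.X i) (ν i) (R i))
    (hc : ∀ i, 0 < coeff lam β η t i) {L : ℝ} (hL : ∀ i, ∀ x ∈ G.actions, |G.u i x| ≤ L)
    (hη : 0 ≤ η t) {i : Fin N} (hηL : η t * d i * L ≤ 1 / 2) {x z : Profile d}
    (hx : x ∈ G.interiorActions) (hz : ∀ i, ‖z i‖ = 1) (p : E (d i)) :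
    bregman (R i) p (nextPivot G R lam β η t x z i) +
        coeff lam β η t i / 2 * ‖p - nextPivot G R lam β η t x z i‖ ^ 2 ≤
      bregman (R i) p (x i) + coeff lam β η t i / 2 * ‖p - x i‖ ^ 2 +
        η t * inner ℝ (gradEst G R lam β η t x z i) (x i - p) + 2 * (η t * d i * L) ^ 2 := by
  refine (hR i).bregman_prox_add_sq_le (G.compact_X i) (G.convex_X i) (hc i) hηL
    (SmoothConcaveGame.mem_interiorActions.1 hx i) fun h => ?_
  calc η t * inner ℝ (gradEst G R lam β η t x z i) h
      ≤ η t * (d i * L * √(hessForm (R i) (x i) h + coeff lam β η t i * ‖h‖ ^ 2)) := by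
        gcongr
        exact inner_gradEst_le hR hc hL hx hz i h
    _ = _ := by ring

end Round

/-! ### The random pivots -/

section Sampling

theorem measurable_comp_of_continuousOn {Ω α γ : Type*} [MeasurableSpace Ω] [TopologicalSpace α]
    [MeasurableSpace α] [OpensMeasurableSpace α] [TopologicalSpace γ] [MeasurableSpace γ]
    [BorelSpace γ] {F : α → γ} {S : Set α} (hF : ContinuousOn F S) {f : Ω → α}
    (hf : Measurable f) (hfS : ∀ ω, f ω ∈ S) : Measurable fun ω => F (f ω) :=
  (continuousOn_iff_continuous_domRestrict.1 hF).measurable.comp (hf.subtype_mk (h := hfS))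

theorem indepFun_subtypeMk {Ω α γ : Type*} [MeasurableSpace Ω] [MeasurableSpace α]
    [MeasurableSpace γ] {P : Measure Ω} {S : Set α} {f : Ω → α} {g : Ω → γ} (hfg : IndepFun f g P)
    (hfS : ∀ ω, f ω ∈ S) : IndepFun (fun ω => (⟨f ω, hfS ω⟩ : S)) g P := by
  have hcomap : MeasurableSpace.comap (fun ω => (⟨f ω, hfS ω⟩ : S)) inferInstance =
      MeasurableSpace.comap f inferInstance :=
    MeasurableSpace.comap_comp
  rw [IndepFun_iff_Indep] at hfg ⊢
  rwa [hcomap]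

theorem integral_comp_prodMk_le_of_indepFun {Ω α γ : Type*} [MeasurableSpace Ω]
    [MeasurableSpace α] [MeasurableSpace γ] {P : Measure Ω} [IsProbabilityMeasure P] {f : Ω → α}
    {g : Ω → γ} (hf : Measurable f) (hg : Measurable g) (hfg : IndepFun f g P) {H : α × γ → ℝ}
    (hH : Integrable H ((P.map f).prod (P.map g))) {Φ : α → ℝ} (hΦ : Integrable Φ (P.map f))
    (hle : ∀ a, ∫ c, H (a, c) ∂P.map g ≤ Φ a) : ∫ ω, H (f ω, g ω) ∂P ≤ ∫ ω, Φ (f ω) ∂P := by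
  have := Measure.isProbabilityMeasure_map (μ := P) hf.aemeasurable
  have := Measure.isProbabilityMeasure_map (μ := P) hg.aemeasurable
  have hmap : P.map (fun ω => (f ω, g ω)) = (P.map f).prod (P.map g) :=
    (indepFun_iff_map_prod_eq_prod_map_map hf.aemeasurable hg.aemeasurable).1 hfg
  calc ∫ ω, H (f ω, g ω) ∂P = ∫ p, H p ∂(P.map f).prod (P.map g) := by
        rw [← hmap, integral_map (hf.prodMk hg).aemeasurable (hmap ▸ hH.aestronglyMeasurable)]
    _ = ∫ a, ∫ c, H (a, c) ∂P.map g ∂P.map f := integral_prod H hH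
    _ ≤ ∫ a, Φ a ∂P.map f := integral_mono hH.integral_prod_left hΦ hle
    _ = ∫ ω, Φ (f ω) ∂P := integral_map hf.aemeasurable hΦ.aestronglyMeasurable

variable {N : ℕ} {d : Fin N → ℕ} {G : SmoothConcaveGame N d} {R : (i : Fin N) → E (d i) → ℝ}
  {ν : Fin N → ℝ} {lam : Fin N → ℝ} {β : ℝ} {η : ℕ → ℝ} {t : ℕ}

theorem pivot_succ (z : ℕ → Profile d) (ht : 1 ≤ t) :
    pivot G R lam β η z (t + 1) =
      nextPivot G R lam β η t (pivot G R lam β η z t) (z t) := by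
  obtain ⟨t, rfl⟩ := Nat.exists_eq_add_of_le' ht
  rfl

theorem pivot_one_mem_interiorActions (hR : ∀ i, IsSelfConcordantBarrier (G.X i) (ν i) (R i))
    (hint : ∀ i, (interior (G.X i)).Nonempty) (z : ℕ → Profile d) :
    pivot G R lam β η z 1 ∈ G.interiorActions :=
  SmoothConcaveGame.mem_interiorActions.2 fun i =>
    ((hR i).argminOn_spec (G.compact_X i) (hint i)).1

theorem isCompact_setOf_norm_eq_one : IsCompact {z : Profile d | ∀ i, ‖z i‖ = 1} := by
  have hpi : {z : Profile d | ∀ i, ‖z i‖ = 1} =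
      Set.univ.pi fun i => Metric.sphere (0 : E (d i)) 1 := by
    ext z
    simp
  rw [hpi]
  exact isCompact_univ_pi fun i => isCompact_sphere _ _

theorem exists_isCompact_pivot_mem (hR : ∀ i, IsSelfConcordantBarrier (G.X i) (ν i) (R i))
    (hint : ∀ i, (interior (G.X i)).Nonempty) (hc : ∀ t, 1 ≤ t → ∀ i, 0 < coeff lam β η t i)
    (ht : 1 ≤ t) :
    ∃ K : Set (Profile d), IsCompact K ∧ K ⊆ G.interiorActions ∧
      ∀ z : ℕ → Profile d, (∀ t i, ‖z t i‖ = 1) → pivot G R lam β η z t ∈ K := by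
  induction t, ht using Nat.le_induction with
  | base =>
    refine ⟨{pivot G R lam β η (fun _ _ => 0) 1}, isCompact_singleton, ?_, fun z _ => rfl⟩
    exact Set.singleton_subset_iff.2 (pivot_one_mem_interiorActions hR hint _)
  | succ t ht ih =>
    obtain ⟨K, hK, hKint, hpivot⟩ := ih
    refine ⟨(fun p : Profile d × Profile d => nextPivot G R lam β η t p.1 p.2) ''
      (K ×ˢ {z : Profile d | ∀ i, ‖z i‖ = 1}), ?_, ?_, fun z hz => ?_⟩
    · exact (hK.prod isCompact_setOf_norm_eq_one).image_of_continuousOn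
        ((continuousOn_nextPivot hR (hc t ht)).mono fun p hp => ⟨hKint hp.1, hp.2⟩)
    · rintro _ ⟨p, hp, rfl⟩
      exact nextPivot_mem_interiorActions hR (hKint hp.1) p.2
    · rw [pivot_succ z ht]
      exact ⟨(_, z t), ⟨hpivot z hz, hz t⟩, rfl⟩

variable {Ω : Type*} {mΩ : MeasurableSpace Ω} {P : Measure Ω}
  {z : ℕ → (i : Fin N) → Ω → Metric.sphere (0 : E (d i)) 1}

/-- The directions of the rounds `t ≥ 1` are uniform, and independent over rounds and players. -/
structure IsUniformSampling (P : Measure Ω)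
    (z : ℕ → (i : Fin N) → Ω → Metric.sphere (0 : E (d i)) 1) : Prop where
  measurable : ∀ t, 1 ≤ t → ∀ i, Measurable (z t i)
  map_eq : ∀ t, 1 ≤ t → ∀ i, P.map (z t i) = sphereUniform (d i)
  indep : iIndepFun (fun p : {t : ℕ // 1 ≤ t} × Fin N => z p.1 p.2) P

/-- The joint directions drawn in round `t`. -/
def roundDirections (z : ℕ → (i : Fin N) → Ω → Metric.sphere (0 : E (d i)) 1) (t : ℕ) (ω : Ω) :
    Directions d := fun i => z t i ω

/-- The pivot of round `t` along the drawn directions. -/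
def randomPivot (G : SmoothConcaveGame N d) (R : (i : Fin N) → E (d i) → ℝ) (lam : Fin N → ℝ)
    (β : ℝ) (η : ℕ → ℝ) (z : ℕ → (i : Fin N) → Ω → Metric.sphere (0 : E (d i)) 1) (t : ℕ)
    (ω : Ω) : Profile d :=
  pivot G R lam β η (fun t => (roundDirections z t ω).toProfile) t

theorem randomPivot_succ (ht : 1 ≤ t) (ω : Ω) :
    randomPivot G R lam β η z (t + 1) ω = nextPivot G R lam β η t
      (randomPivot G R lam β η z t ω) (roundDirections z t ω).toProfile :=
  pivot_succ _ ht

theorem exists_isCompact_randomPivot_mem (hR : ∀ i, IsSelfConcordantBarrier (G.X i) (ν i) (R i))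
    (hint : ∀ i, (interior (G.X i)).Nonempty) (hc : ∀ t, 1 ≤ t → ∀ i, 0 < coeff lam β η t i)
    (z : ℕ → (i : Fin N) → Ω → Metric.sphere (0 : E (d i)) 1) (ht : 1 ≤ t) :
    ∃ K : Set (Profile d), IsCompact K ∧ K ⊆ G.interiorActions ∧
      ∀ ω, randomPivot G R lam β η z t ω ∈ K := by
  obtain ⟨K, hK, hKint, hpivot⟩ := exists_isCompact_pivot_mem hR hint hc ht
  exact ⟨K, hK, hKint, fun ω => hpivot _ fun t => (roundDirections z t ω).norm_toProfile⟩

theorem randomPivot_mem_interiorActions (hR : ∀ i, IsSelfConcordantBarrier (G.X i) (ν i) (R i))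
    (hint : ∀ i, (interior (G.X i)).Nonempty) (hc : ∀ t, 1 ≤ t → ∀ i, 0 < coeff lam β η t i)
    (z : ℕ → (i : Fin N) → Ω → Metric.sphere (0 : E (d i)) 1) (ht : 1 ≤ t) (ω : Ω) :
    randomPivot G R lam β η z t ω ∈ G.interiorActions := by
  obtain ⟨K, -, hKint, hpivot⟩ := exists_isCompact_randomPivot_mem hR hint hc z ht
  exact hKint (hpivot ω)

theorem measurable_randomPivot (hR : ∀ i, IsSelfConcordantBarrier (G.X i) (ν i) (R i))
    (hint : ∀ i, (interior (G.X i)).Nonempty) (hc : ∀ t, 1 ≤ t → ∀ i, 0 < coeff lam β η t i)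
    (ht : 1 ≤ t) (hz : ∀ s, 1 ≤ s → s < t → ∀ i, Measurable (z s i)) :
    Measurable (randomPivot G R lam β η z t) := by
  induction t, ht using Nat.le_induction with
  | base => exact measurable_const
  | succ t ht ih =>
    have hpivot := ih fun s hs hst => hz s hs (hst.trans (Nat.lt_succ_self t))
    have hdir : Measurable fun ω => (roundDirections z t ω).toProfile :=
      measurable_pi_lambda _ fun i =>
        measurable_subtype_coe.comp (hz t ht (Nat.lt_succ_self t) i)
    simp only [funext (randomPivot_succ ht)]
    exact measurable_comp_of_continuousOn
      (F := fun p : Profile d × Profile d => nextPivot G R lam β η t p.1 p.2)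
      (f := fun ω => (randomPivot G R lam β η z t ω, (roundDirections z t ω).toProfile))
      (continuousOn_nextPivot hR (hc t ht)) (hpivot.prodMk hdir) fun ω =>
        mem_roundDomain (randomPivot_mem_interiorActions hR hint hc z ht ω) _

theorem IsUniformSampling.measurable_roundDirections (hz : IsUniformSampling P z) (ht : 1 ≤ t) :
    Measurable (roundDirections z t) :=
  measurable_pi_lambda _ (hz.measurable t ht)

theorem IsUniformSampling.map_roundDirections (hz : IsUniformSampling P z) (ht : 1 ≤ t) :
    P.map (roundDirections z t) = directionLaw d := by
  have hindep := hz.indep.precomp (g := fun i : Fin N => ((⟨t, ht⟩, i) : {t : ℕ // 1 ≤ t} × Fin N))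
    (fun i j hij => by simpa using hij)
  have := hindep.isProbabilityMeasure
  refine ((iIndepFun_iff_map_fun_eq_pi_map fun i =>
    (hz.measurable t ht i).aemeasurable).1 hindep).trans ?_
  exact congrArg Measure.pi (funext (hz.map_eq t ht))

theorem IsUniformSampling.indepFun_randomPivot (hz : IsUniformSampling P z)
    (hR : ∀ i, IsSelfConcordantBarrier (G.X i) (ν i) (R i))
    (hint : ∀ i, (interior (G.X i)).Nonempty) (hc : ∀ t, 1 ≤ t → ∀ i, 0 < coeff lam β η t i)
    (ht : 1 ≤ t) : IndepFun (randomPivot G R lam β η z t) (roundDirections z t) P := by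
  let m : {t : ℕ // 1 ≤ t} × Fin N → MeasurableSpace Ω :=
    fun p => MeasurableSpace.comap (z p.1 p.2) inferInstance
  have hm : ∀ p, m p ≤ mΩ := fun p => (hz.measurable p.1 p.1.2 p.2).comap_le
  have hdisj : Disjoint {p : {t : ℕ // 1 ≤ t} × Fin N | (p.1 : ℕ) < t} {p | (p.1 : ℕ) = t} :=
    Set.disjoint_left.2 fun p hlt heq => absurd heq (ne_of_lt hlt)
  rw [IndepFun_iff_Indep]
  refine indep_of_indep_of_le_left (indep_of_indep_of_le_right
    (indep_iSup_of_disjoint hm hz.indep hdisj) ?_) ?_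
  · rw [← measurable_iff_comap_le]
    refine @measurable_pi_lambda _ _ _ (_) _ _ fun i => measurable_iff_comap_le.2 ?_
    exact le_iSup₂_of_le (f := fun p _ => m p) (⟨⟨t, ht⟩, i⟩ : {t : ℕ // 1 ≤ t} × Fin N) rfl le_rfl
  · rw [← measurable_iff_comap_le]
    refine measurable_randomPivot hR hint hc ht fun s hs hst i => measurable_iff_comap_le.2 ?_
    exact le_iSup₂_of_le (f := fun p _ => m p) (⟨⟨s, hs⟩, i⟩ : {t : ℕ // 1 ≤ t} × Fin N) hst le_rfl

/- Conditioning on the past: the directions of a round are independent of its pivot, so a bound on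
the average over the directions for every fixed pivot survives the averaging over the pivot. -/
theorem IsUniformSampling.integral_comp_randomPivot_le [IsProbabilityMeasure P]
    (hz : IsUniformSampling P z) (hR : ∀ i, IsSelfConcordantBarrier (G.X i) (ν i) (R i))
    (hint : ∀ i, (interior (G.X i)).Nonempty) (hc : ∀ t, 1 ≤ t → ∀ i, 0 < coeff lam β η t i)
    (ht : 1 ≤ t) {H : Profile d × Profile d → ℝ} (hH : ContinuousOn H (roundDomain G))
    {Φ : Profile d → ℝ} (hΦ : ContinuousOn Φ G.interiorActions)
    (hle : ∀ x ∈ G.interiorActions, ∫ ξ, H (x, ξ.toProfile) ∂directionLaw d ≤ Φ x) :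
    ∫ ω, H (randomPivot G R lam β η z t ω, (roundDirections z t ω).toProfile) ∂P ≤
      ∫ ω, Φ (randomPivot G R lam β η z t ω) ∂P := by
  obtain ⟨K, hK, hKint, hpivot⟩ :=
    exists_isCompact_randomPivot_mem (η := η) (lam := lam) (β := β) hR hint hc z ht
  have : CompactSpace K := isCompact_iff_compactSpace.1 hK
  have hdir := hz.measurable_roundDirections ht
  have hx : Measurable (randomPivot G R lam β η z t) :=
    measurable_randomPivot hR hint hc ht fun s hs _ => hz.measurable s hs
  let x' : Ω → K := fun ω => ⟨randomPivot G R lam β η z t ω, hpivot ω⟩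
  have hx' : Measurable x' := hx.subtype_mk
  have := Measure.isProbabilityMeasure_map (μ := P) hx'.aemeasurable
  have := Measure.isProbabilityMeasure_map (μ := P) hdir.aemeasurable
  have hHcont : Continuous fun p : K × Directions d => H (p.1, p.2.toProfile) :=
    hH.comp_continuous ((continuous_subtype_val.comp continuous_fst).prodMk
      (Directions.continuous_toProfile.comp continuous_snd))
      fun p => mem_roundDomain (hKint p.1.2) p.2
  have hΦcont : Continuous fun x : K => Φ x :=
    hΦ.comp_continuous continuous_subtype_val fun x => hKint x.2
  refine integral_comp_prodMk_le_of_indepFun (f := x') (Φ := fun x : K => Φ x)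
    (H := fun p : K × Directions d => H (p.1, p.2.toProfile)) hx' hdir
    (indepFun_subtypeMk (hz.indepFun_randomPivot hR hint hc ht) hpivot)
    (hHcont.integrable_of_hasCompactSupport (HasCompactSupport.of_compactSpace _))
    (hΦcont.integrable_of_hasCompactSupport (HasCompactSupport.of_compactSpace _)) fun x => ?_
  rw [hz.map_roundDirections ht]
  exact hle x (hKint x.2)

end Sampling

/-! ### Equilibria -/

section Equilibrium

variable {N : ℕ} {d : Fin N → ℕ}

theorem sqDist_nonneg (x y : Profile d) : 0 ≤ sqDist x y :=
  Finset.sum_nonneg fun _ _ => sq_nonneg _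

theorem sqDist_comm (x y : Profile d) : sqDist x y = sqDist y x := by
  simp only [sqDist, norm_sub_rev]

theorem sqDist_eq_zero {x y : Profile d} : sqDist x y = 0 ↔ x = y := by
  rw [sqDist, Finset.sum_eq_zero_iff_of_nonneg fun _ _ => sq_nonneg _, funext_iff]
  simp [sub_eq_zero]

theorem sqDist_le_three_mul (w x y z : Profile d) :
    sqDist w z ≤ 3 * (sqDist w x + sqDist x y + sqDist y z) := by
  simp only [sqDist, ← Finset.sum_add_distrib, Finset.mul_sum]
  refine Finset.sum_le_sum fun i _ => ?_
  have htri : ‖w i - z i‖ ≤ ‖w i - x i‖ + ‖x i - y i‖ + ‖y i - z i‖ := by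
    rw [← sub_add_sub_cancel (w i) (y i) (z i), ← sub_add_sub_cancel (w i) (x i) (y i)]
    exact norm_add₃_le
  refine (pow_le_pow_left₀ (norm_nonneg _) htri 2).trans ?_
  nlinarith [sq_nonneg (‖w i - x i‖ - ‖x i - y i‖), sq_nonneg (‖w i - x i‖ - ‖y i - z i‖),
    sq_nonneg (‖x i - y i‖ - ‖y i - z i‖)]

theorem sqDist_le_mul_sq {x y : Profile d} {r : ℝ} (h : ∀ i, ‖x i - y i‖ ≤ r) :
    sqDist x y ≤ N * r ^ 2 := by
  calc sqDist x y ≤ ∑ _i : Fin N, r ^ 2 :=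
        Finset.sum_le_sum fun i _ => pow_le_pow_left₀ (norm_nonneg _) (h i) 2
    _ = N * r ^ 2 := by simp

theorem continuous_sqDist_left (y : Profile d) : Continuous fun x => sqDist x y :=
  continuous_finsetSum _ fun i _ => (((continuous_apply i).sub continuous_const).norm).pow 2

namespace SmoothConcaveGame

variable {G : SmoothConcaveGame N d} {lam : Fin N → ℝ} {β : ℝ}

theorem v_eq_zero_of_forall_u_eq {i : Fin N} {c : ℝ} (hu : ∀ x ∈ G.actions, G.u i x = c)
    {x : Profile d} (hx : x ∈ G.actions) : G.v i x = 0 := by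
  have hconst : Set.EqOn (fun y => G.u i (Function.update x i y)) (fun _ => c) (G.X i) :=
    fun y hy => hu _ (update_mem_actions hx hy)
  have hfderiv : fderivWithin ℝ (fun y => G.u i (Function.update x i y)) (G.X i) (x i) = 0 := by
    rw [fderivWithin_congr hconst (hconst (mem_actions.1 hx i))]
    simp
  simp [v, payoffGrad, gradientWithin, hfderiv]

theorem IsNash.inner_v_nonpos {x : Profile d} (hx : G.IsNash x) {i : Fin N} {y : E (d i)}
    (hy : y ∈ G.X i) : inner ℝ (G.v i x) (y - x i) ≤ 0 := by
  have hxi := mem_actions.1 hx.1 i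
  have hmax : IsLocalMaxOn (fun y => G.u i (Function.update x i y)) (G.X i) (x i) := by
    filter_upwards [self_mem_nhdsWithin] with y hy
    simpa using hx.2 i y hy
  simpa using hmax.hasFDerivWithinAt_nonpos (hasFDerivWithinAt_u_update hx.1 hxi)
    (sub_mem_posTangentConeAt_of_segment_subset ((G.convex_X i).segment_subset hxi hy))

theorem IsNash.eq (hmono : G.IsStronglyMonotone lam β) {x y : Profile d} (hx : G.IsNash x)
    (hy : G.IsNash y) : y = x := by
  obtain ⟨hβ, hlam, hmono⟩ := hmono
  have hinner : 0 ≤ ∑ i, lam i * inner ℝ (y i - x i) (G.v i y - G.v i x) := by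
    refine Finset.sum_nonneg fun i _ => mul_nonneg (hlam i).le ?_
    have hvx := hx.inner_v_nonpos (mem_actions.1 hy.1 i)
    have hvy := hy.inner_v_nonpos (mem_actions.1 hx.1 i)
    rw [← neg_sub, inner_neg_right] at hvy
    rw [real_inner_comm, inner_sub_left]
    linarith
  have hdist : sqDist x y ≤ 0 := by
    have := hmono x hx.1 y hy.1
    nlinarith
  exact (sqDist_eq_zero.1 (hdist.antisymm (sqDist_nonneg x y))).symm

theorem nontrivial_X {i : Fin N} (hd : 1 ≤ d i) (hint : (interior (G.X i)).Nonempty) :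
    (G.X i).Nontrivial := by
  obtain ⟨a, ha⟩ := hint
  have : NeZero (d i) := ⟨by omega⟩
  have := Module.punctured_nhds_neBot ℝ (E (d i)) a
  exact (infinite_of_mem_nhds a (mem_interior_iff_mem_nhds.1 ha)).nontrivial

theorem payoff_bound_pos {i : Fin N} (hd : 1 ≤ d i) (hint : ∀ i, (interior (G.X i)).Nonempty)
    (hmono : G.IsStronglyMonotone lam β) {L : ℝ} (hL : ∀ i, ∀ x ∈ G.actions, |G.u i x| ≤ L) :
    0 < L := by
  by_contra! hL0
  have hv : ∀ j, ∀ x ∈ G.actions, G.v j x = 0 := fun j x hx =>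
    v_eq_zero_of_forall_u_eq (fun y hy => abs_nonpos_iff.1 ((hL j y hy).trans hL0)) hx
  choose x hx using fun j => (hint j).mono interior_subset
  have hx : x ∈ G.actions := mem_actions.2 hx
  obtain ⟨a, ha, hax⟩ := (nontrivial_X hd (hint i)).exists_ne (x i)
  have hy := update_mem_actions hx ha
  have hdist : 0 < sqDist x (Function.update x i a) := by
    refine (sqDist_nonneg _ _).lt_of_ne' fun h => hax ?_
    simpa using (congrFun (sqDist_eq_zero.1 h) i).symm
  have := hmono.2.2 x hx _ hy
  simp only [hv _ x hx, hv _ _ hy, sub_zero, inner_zero_right, mul_zero,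
    Finset.sum_const_zero] at this
  nlinarith [hmono.1]

theorem GradLipschitzWith.inner_v_le {ℓ : NNReal} (hℓ : G.GradLipschitzWith ℓ)
    {xstar : Profile d} (hstar : G.IsNash xstar) {r : ℝ} {p : Profile d} (hp : p ∈ G.actions)
    (hpr : ∀ j, ‖p j - xstar j‖ ≤ r) {x : Profile d} (hx : x ∈ G.actions) (i : Fin N) :
    inner ℝ (G.v i p) (x i - p i) ≤ (ℓ * √N * G.diameter + ‖G.v i xstar‖) * r := by
  have hr : 0 ≤ r := (norm_nonneg _).trans (hpr i)
  have hdist : √(sqDist p xstar) ≤ √N * r := by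
    rw [← Real.sqrt_sq hr, ← Real.sqrt_mul (Nat.cast_nonneg N)]
    exact Real.sqrt_le_sqrt (sqDist_le_mul_sq hpr)
  have hgrad : inner ℝ (G.v i p - G.v i xstar) (x i - p i) ≤ ℓ * (√N * r) * G.diameter := by
    refine (real_inner_le_norm _ _).trans (mul_le_mul ?_
      (norm_sub_le_diameter (mem_actions.1 hx i) (mem_actions.1 hp i)) (norm_nonneg _)
      (by positivity))
    exact (hℓ i p hp xstar hstar.1).trans (mul_le_mul_of_nonneg_left hdist ℓ.coe_nonneg)
  have hvar := hstar.inner_v_nonpos (mem_actions.1 hx i)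
  have hshift : inner ℝ (G.v i xstar) (xstar i - p i) ≤ ‖G.v i xstar‖ * r := by
    refine (real_inner_le_norm _ _).trans ?_
    rw [norm_sub_rev]
    exact mul_le_mul_of_nonneg_left (hpr i) (norm_nonneg _)
  have hsplit : inner ℝ (G.v i p) (x i - p i) = inner ℝ (G.v i p - G.v i xstar) (x i - p i) +
      (inner ℝ (G.v i xstar) (x i - xstar i) + inner ℝ (G.v i xstar) (xstar i - p i)) := by
    rw [inner_sub_left, ← inner_add_right, sub_add_sub_cancel, sub_add_cancel]
  rw [hsplit]
  linarith

end SmoothConcaveGame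

end Equilibrium

/-! ### The expected potential -/

section Potential

variable {N : ℕ} {d : Fin N → ℕ} {G : SmoothConcaveGame N d} {R : (i : Fin N) → E (d i) → ℝ}
  {ν : Fin N → ℝ} {lam : Fin N → ℝ} {β : ℝ} {η : ℕ → ℝ} {t : ℕ}

theorem mul_integral_inner_gradEst_le (hd : ∀ i, 1 ≤ d i)
    (hR : ∀ i, IsSelfConcordantBarrier (G.X i) (ν i) (R i))
    (hc : ∀ i, 0 < coeff lam β η t i) {ℓ : NNReal} (hℓ : G.GradLipschitzWith ℓ) (hβ : 0 < β)
    {i : Fin N} (hlam : 0 ≤ lam i) {x : Profile d} (hx : x ∈ G.interiorActions) (h : E (d i)) :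
    lam i * ∫ z, inner ℝ (gradEst G R lam β η t x z.toProfile i) h ∂directionLaw d ≤
      lam i * inner ℝ (G.v i x) h +
        ((lam i * ℓ) ^ 2 / (2 * β) * ∑ j, 1 / coeff lam β η t j + β / 2 * ‖h‖ ^ 2) := by
  set S := ∑ j, 1 / coeff lam β η t j
  have hS : √S ^ 2 = S :=
    Real.sq_sqrt (Finset.sum_nonneg fun j _ => (one_div_pos.2 (hc j)).le)
  have hbias := mul_le_mul_of_nonneg_left
    (sub_le_iff_le_add.1 (abs_le.1 (abs_integral_inner_gradEst_sub_le hd hR hc hℓ hx i h)).2) hlam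
  have hyoung : lam i * (ℓ * √S * ‖h‖) ≤ (lam i * ℓ) ^ 2 / (2 * β) * S + β / 2 * ‖h‖ ^ 2 := by
    rw [div_mul_eq_mul_div, div_add' _ _ _ (by positivity), le_div_iff₀ (by positivity)]
    nlinarith [sq_nonneg (lam i * ℓ * √S - β * ‖h‖)]
  linarith

theorem integral_sum_inner_gradEst_le (hd : ∀ i, 1 ≤ d i)
    (hR : ∀ i, IsSelfConcordantBarrier (G.X i) (ν i) (R i))
    (hmono : G.IsStronglyMonotone lam β) (hc : ∀ i, 0 < coeff lam β η t i)
    {ℓ : NNReal} (hℓ : G.GradLipschitzWith ℓ) {p : Profile d} (hp : p ∈ G.actions) {ε : ℝ}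
    (hε : ∀ x ∈ G.actions, ∑ i, lam i * inner ℝ (G.v i p) (x i - p i) ≤ ε)
    {x : Profile d} (hx : x ∈ G.interiorActions) :
    ∫ z : Directions d, (∑ i, lam i *
      inner ℝ (gradEst G R lam β η t x z.toProfile i) (x i - p i)) ∂directionLaw d ≤
    -(β / 2) * sqDist x p +
      (ε + (∑ i, (lam i * ℓ) ^ 2) / (2 * β) * ∑ j, 1 / coeff lam β η t j) := by
  obtain ⟨hβ, hlam, hmono⟩ := hmono
  have hxa := SmoothConcaveGame.interiorActions_subset hx
  have hsplit : ∑ i, lam i * inner ℝ (G.v i x) (x i - p i) =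
      ∑ i, lam i * inner ℝ (x i - p i) (G.v i x - G.v i p) +
        ∑ i, lam i * inner ℝ (G.v i p) (x i - p i) := by
    rw [← Finset.sum_add_distrib]
    refine Finset.sum_congr rfl fun i _ => ?_
    rw [← mul_add, real_inner_comm (G.v i x - G.v i p), ← inner_add_left, sub_add_cancel]
  rw [integral_finsetSum _ fun i _ => ((integrable_directionLaw_of_continuous hd
    (continuous_inner_gradEst hR hc hx i _)).const_mul _)]
  simp only [integral_const_mul]
  refine (Finset.sum_le_sum fun i _ =>
    mul_integral_inner_gradEst_le hd hR hc hℓ hβ (hlam i).le hx (x i - p i)).trans ?_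
  rw [Finset.sum_add_distrib, Finset.sum_add_distrib, hsplit, ← Finset.mul_sum,
    ← Finset.sum_mul, ← Finset.sum_div]
  have hpx := hmono p hp x hxa
  rw [sqDist_comm] at hpx
  rw [← sqDist]
  linarith [hε x hxa]

/-- The Lyapunov function of the algorithm: the weighted Bregman divergences of `p` from the
pivot `x`, plus `c` times their squared distance. -/
def potential (R : (i : Fin N) → E (d i) → ℝ) (lam : Fin N → ℝ) (p : Profile d) (c : ℝ)
    (x : Profile d) : ℝ :=
  ∑ i, lam i * bregman (R i) (p i) (x i) + c * sqDist x p

theorem continuousOn_potential (hR : ∀ i, IsSelfConcordantBarrier (G.X i) (ν i) (R i))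
    (p : Profile d) (c : ℝ) : ContinuousOn (potential R lam p c) G.interiorActions := by
  refine (continuousOn_finsetSum _ fun i _ => continuousOn_const.mul ?_).add
    (continuousOn_const.mul (continuous_sqDist_left p).continuousOn)
  have hx : ContinuousOn (fun x : Profile d => x i) G.interiorActions :=
    (continuous_apply i).continuousOn
  have hmaps : Set.MapsTo (fun x : Profile d => x i) G.interiorActions (interior (G.X i)) :=
    fun x hx => SmoothConcaveGame.mem_interiorActions.1 hx i
  exact (continuousOn_const.sub ((hR i).contDiffOn.continuousOn.comp hx hmaps)).sub
    (((hR i).continuousOn_gradient.comp hx hmaps).inner (continuousOn_const.sub hx))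

theorem mul_sqDist_le_potential (hR : ∀ i, IsSelfConcordantBarrier (G.X i) (ν i) (R i))
    (hlam : ∀ i, 0 ≤ lam i) (c : ℝ) {p x : Profile d} (hp : p ∈ G.interiorActions)
    (hx : x ∈ G.interiorActions) : c * sqDist x p ≤ potential R lam p c x :=
  le_add_of_nonneg_left <| Finset.sum_nonneg fun i _ =>
    mul_nonneg (hlam i) ((hR i).bregman_nonneg (G.convex_X i)
      (SmoothConcaveGame.mem_interiorActions.1 hx i)
      (SmoothConcaveGame.mem_interiorActions.1 hp i))

theorem potential_mono (R : (i : Fin N) → E (d i) → ℝ) (lam : Fin N → ℝ) {c c' : ℝ}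
    (hcc' : c ≤ c') (p x : Profile d) : potential R lam p c x ≤ potential R lam p c' x :=
  add_le_add_right (mul_le_mul_of_nonneg_right hcc' (sqDist_nonneg x p)) _

theorem potential_nextPivot_le (hR : ∀ i, IsSelfConcordantBarrier (G.X i) (ν i) (R i))
    (hlam : ∀ i, 0 < lam i) (hc : ∀ i, 0 < coeff lam β η t i) {L : ℝ}
    (hL : ∀ i, ∀ x ∈ G.actions, |G.u i x| ≤ L) (hη : 0 ≤ η t)
    (hηL : ∀ i, η t * d i * L ≤ 1 / 2) {x z : Profile d} (hx : x ∈ G.interiorActions)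
    (hz : ∀ i, ‖z i‖ = 1) (p : Profile d) :
    potential R lam p (η t * β * (t + 1) / 2) (nextPivot G R lam β η t x z) ≤
      potential R lam p (η t * β * (t + 1) / 2) x +
        η t * (∑ i, lam i * inner ℝ (gradEst G R lam β η t x z i) (x i - p i)) +
        ∑ i, lam i * (2 * (η t * d i * L) ^ 2) := by
  simp only [potential, sqDist, Finset.mul_sum, ← Finset.sum_add_distrib]
  refine Finset.sum_le_sum fun i _ => ?_
  have hmirror := mul_le_mul_of_nonneg_left
    (bregman_nextPivot_add_sq_le hR hc hL hη (hηL i) hx hz (p i)) (hlam i).le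
  have hcoeff : η t * β * (t + 1) = coeff lam β η t i * lam i := by
    rw [coeff, div_mul_cancel₀ _ (hlam i).ne']
  rw [norm_sub_rev (p i), norm_sub_rev (p i)] at hmirror
  rw [hcoeff]
  linarith

/- The drift `-(β / 2) * sqDist x p` of the estimated gradients is exactly what lowers the
coefficient of the squared distance from `η t * β * (t + 1) / 2` to `η t * β * t / 2`. -/
theorem integral_potential_nextPivot_le (hd : ∀ i, 1 ≤ d i)
    (hR : ∀ i, IsSelfConcordantBarrier (G.X i) (ν i) (R i))
    (hmono : G.IsStronglyMonotone lam β) (hc : ∀ i, 0 < coeff lam β η t i) {L : ℝ}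
    (hL : ∀ i, ∀ x ∈ G.actions, |G.u i x| ≤ L) (hη : 0 ≤ η t)
    (hηL : ∀ i, η t * d i * L ≤ 1 / 2) {ℓ : NNReal} (hℓ : G.GradLipschitzWith ℓ)
    {p : Profile d} (hp : p ∈ G.actions) {ε : ℝ}
    (hε : ∀ x ∈ G.actions, ∑ i, lam i * inner ℝ (G.v i p) (x i - p i) ≤ ε)
    {x : Profile d} (hx : x ∈ G.interiorActions) :
    ∫ z, potential R lam p (η t * β * (t + 1) / 2) (nextPivot G R lam β η t x z.toProfile)
        ∂directionLaw d ≤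
      potential R lam p (η t * β * t / 2) x +
        (η t * (ε + (∑ i, (lam i * ℓ) ^ 2) / (2 * β) * ∑ j, 1 / coeff lam β η t j) +
          ∑ i, lam i * (2 * (η t * d i * L) ^ 2)) := by
  have := isProbabilityMeasure_directionLaw hd
  let drift : Directions d → ℝ := fun z =>
    ∑ i, lam i * inner ℝ (gradEst G R lam β η t x z.toProfile i) (x i - p i)
  have hpot : Integrable (fun z : Directions d => potential R lam p (η t * β * (t + 1) / 2)
      (nextPivot G R lam β η t x z.toProfile)) (directionLaw d) :=
    integrable_directionLaw_of_continuous hd <| (continuousOn_potential hR p _).comp_continuous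
      (continuous_nextPivot hR hc hx) fun z => nextPivot_mem_interiorActions hR hx z.toProfile
  have hdrift : Integrable drift (directionLaw d) :=
    integrable_directionLaw_of_continuous hd <| continuous_finsetSum _ fun i _ =>
      continuous_const.mul (continuous_inner_gradEst hR hc hx i _)
  set Q := ∑ i, lam i * (2 * (η t * d i * L) ^ 2)
  calc ∫ z, potential R lam p (η t * β * (t + 1) / 2) (nextPivot G R lam β η t x z.toProfile)
          ∂directionLaw d
      ≤ ∫ z, (potential R lam p (η t * β * (t + 1) / 2) x + Q + η t * drift z)
          ∂directionLaw d := by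
        refine integral_mono hpot ((integrable_const _).add (hdrift.const_mul _)) fun z => ?_
        have hstep := potential_nextPivot_le hR hmono.2.1 hc hL hη hηL hx z.norm_toProfile p
        exact hstep.trans_eq (add_right_comm _ _ _)
    _ = potential R lam p (η t * β * (t + 1) / 2) x + Q +
          η t * ∫ z, drift z ∂directionLaw d := by
        rw [integral_add (integrable_const _) (hdrift.const_mul _), integral_const_mul]
        simp
    _ ≤ _ := by
        have hle := mul_le_mul_of_nonneg_left
          (integral_sum_inner_gradEst_le hd hR hmono hc hℓ hp hε hx) hη
        unfold potential
        linarith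

variable {Ω : Type*} {mΩ : MeasurableSpace Ω} {P : Measure Ω} [IsProbabilityMeasure P]
  {z : ℕ → (i : Fin N) → Ω → Metric.sphere (0 : E (d i)) 1}

theorem IsUniformSampling.integrable_comp (hz : IsUniformSampling P z)
    (hR : ∀ i, IsSelfConcordantBarrier (G.X i) (ν i) (R i))
    (hint : ∀ i, (interior (G.X i)).Nonempty) (hc : ∀ t, 1 ≤ t → ∀ i, 0 < coeff lam β η t i)
    (ht : 1 ≤ t) {H : Profile d × Profile d → ℝ} (hH : ContinuousOn H (roundDomain G)) :
    Integrable (fun ω => H (randomPivot G R lam β η z t ω, (roundDirections z t ω).toProfile))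
      P := by
  obtain ⟨K, hK, hKint, hpivot⟩ :=
    exists_isCompact_randomPivot_mem (η := η) (lam := lam) (β := β) hR hint hc z ht
  obtain ⟨C, hC⟩ := (hK.prod isCompact_setOf_norm_eq_one).exists_bound_of_continuousOn
    (hH.mono fun q hq => ⟨hKint hq.1, hq.2⟩)
  have hmeas : Measurable fun ω =>
      (randomPivot G R lam β η z t ω, (roundDirections z t ω).toProfile) :=
    (measurable_randomPivot hR hint hc ht fun s hs _ => hz.measurable s hs).prodMk
      (Directions.continuous_toProfile.measurable.comp (hz.measurable_roundDirections ht))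
  exact Integrable.of_bound (measurable_comp_of_continuousOn hH hmeas fun ω =>
      mem_roundDomain (hKint (hpivot ω)) _).aestronglyMeasurable C
    (.of_forall fun ω => hC _ ⟨hpivot ω, (roundDirections z t ω).norm_toProfile⟩)

theorem IsUniformSampling.integrable_comp_randomPivot (hz : IsUniformSampling P z)
    (hR : ∀ i, IsSelfConcordantBarrier (G.X i) (ν i) (R i))
    (hint : ∀ i, (interior (G.X i)).Nonempty) (hc : ∀ t, 1 ≤ t → ∀ i, 0 < coeff lam β η t i)
    (ht : 1 ≤ t) {F : Profile d → ℝ} (hF : ContinuousOn F G.interiorActions) :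
    Integrable (fun ω => F (randomPivot G R lam β η z t ω)) P :=
  hz.integrable_comp hR hint hc ht (H := fun q => F q.1)
    (hF.comp continuousOn_fst fun _ hq => hq.1)

theorem IsUniformSampling.integral_potential_succ_le (hz : IsUniformSampling P z)
    (hd : ∀ i, 1 ≤ d i) (hR : ∀ i, IsSelfConcordantBarrier (G.X i) (ν i) (R i))
    (hint : ∀ i, (interior (G.X i)).Nonempty) (hmono : G.IsStronglyMonotone lam β)
    (hc : ∀ t, 1 ≤ t → ∀ i, 0 < coeff lam β η t i) {L : ℝ}
    (hL : ∀ i, ∀ x ∈ G.actions, |G.u i x| ≤ L) (ht : 1 ≤ t) (hη : 0 ≤ η t)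
    (hηL : ∀ i, η t * d i * L ≤ 1 / 2) {ℓ : NNReal} (hℓ : G.GradLipschitzWith ℓ)
    {p : Profile d} (hp : p ∈ G.actions) {ε : ℝ}
    (hε : ∀ x ∈ G.actions, ∑ i, lam i * inner ℝ (G.v i p) (x i - p i) ≤ ε) :
    ∫ ω, potential R lam p (η t * β * (t + 1) / 2) (randomPivot G R lam β η z (t + 1) ω) ∂P ≤
      ∫ ω, potential R lam p (η t * β * t / 2) (randomPivot G R lam β η z t ω) ∂P +
        (η t * (ε + (∑ i, (lam i * ℓ) ^ 2) / (2 * β) * ∑ j, 1 / coeff lam β η t j) +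
          ∑ i, lam i * (2 * (η t * d i * L) ^ 2)) := by
  have hpot := continuousOn_potential (lam := lam) hR p
  simp only [randomPivot_succ ht]
  refine (hz.integral_comp_randomPivot_le hR hint hc ht
    (H := fun q => potential R lam p (η t * β * (t + 1) / 2) (nextPivot G R lam β η t q.1 q.2))
    ((hpot _).comp (continuousOn_nextPivot hR (hc t ht))
      fun q hq => nextPivot_mem_interiorActions hR hq.1 _)
    ((hpot (η t * β * t / 2)).add continuousOn_const) fun x hx =>
      integral_potential_nextPivot_le hd hR hmono (hc t ht) hL hη hηL hℓ hp hε hx).trans_eq ?_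
  simp only [Pi.add_apply]
  rw [integral_add (hz.integrable_comp_randomPivot hR hint hc ht (hpot _)) (integrable_const _)]
  simp

end Potential

/-! ### The rate of convergence -/

section Rate

theorem le_add_log_of_succ_le {V : ℕ → ℝ} {A C : ℝ} (hA : 0 ≤ A) (hC : 0 ≤ C)
    (hV : ∀ t : ℕ, 1 ≤ t → V (t + 1) ≤ V t + (A + C / t)) {T : ℕ} (hT : 1 ≤ T) :
    V T ≤ V 1 + T * A + C * (1 + Real.log T) := by
  have hharmonic : ∀ t : ℕ, V (t + 1) ≤ V 1 + t * A + C * harmonic t := by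
    intro t
    induction t with
    | zero => simp
    | succ t ih =>
      have hstep := hV (t + 1) (by omega)
      rw [harmonic_succ]
      push_cast at hstep ⊢
      rw [div_eq_mul_inv] at hstep
      linarith
  have hmono : ((harmonic (T - 1) : ℚ) : ℝ) ≤ harmonic T := by
    have hadd := harmonic_succ (T - 1)
    rw [Nat.sub_add_cancel hT] at hadd
    rw [hadd]
    push_cast
    exact le_add_of_nonneg_right (by positivity)
  have hlog : C * harmonic (T - 1) ≤ C * (1 + Real.log T) :=
    mul_le_mul_of_nonneg_left (hmono.trans (harmonic_le_one_add_log T)) hC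
  have hlast := hharmonic (T - 1)
  rw [Nat.sub_add_cancel hT, Nat.cast_sub hT] at hlast
  push_cast at hlast
  linarith

theorem le_div_log_two_mul_log {a : ℝ} (ha : 0 ≤ a) {T : ℕ} (hT : 2 ≤ T) :
    a ≤ a / Real.log 2 * Real.log T := by
  rw [div_mul_eq_mul_div, le_div_iff₀ (Real.log_pos one_lt_two)]
  exact mul_le_mul_of_nonneg_left (Real.log_le_log two_pos (by exact_mod_cast hT)) ha

variable {N : ℕ} {d : Fin N → ℕ} {L : ℝ} {lam : Fin N → ℝ} {β : ℝ} {t : ℕ}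

theorem stepSize_pos (hn : 0 < ∑ i, d i) (hL : 0 < L) (ht : 1 ≤ t) : 0 < stepSize d L t := by
  have : (0 : ℝ) < (∑ i, d i : ℕ) := by exact_mod_cast hn
  have : (0 : ℝ) < t := by exact_mod_cast ht
  unfold stepSize
  positivity

theorem stepSize_anti (hn : 0 < ∑ i, d i) (hL : 0 < L) {s : ℕ} (hs : 1 ≤ s) (hst : s ≤ t) :
    stepSize d L t ≤ stepSize d L s := by
  have : (0 : ℝ) < (∑ i, d i : ℕ) := by exact_mod_cast hn
  have : (0 : ℝ) < s := by exact_mod_cast hs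
  unfold stepSize
  gcongr

theorem stepSize_mul_le (hn : 0 < ∑ i, d i) (hL : 0 < L) (ht : 1 ≤ t) (i : Fin N) :
    stepSize d L t * d i * L ≤ 1 / (2 * √t) := by
  have hn : (0 : ℝ) < (∑ i, d i : ℕ) := by exact_mod_cast hn
  have : 0 < √(t : ℝ) := Real.sqrt_pos.2 (by exact_mod_cast ht)
  have hdi : (d i : ℝ) ≤ (∑ i, d i : ℕ) := by
    exact_mod_cast Finset.single_le_sum (fun i _ => Nat.zero_le (d i)) (Finset.mem_univ i)
  have hsplit : stepSize d L t * d i * L = d i / (∑ i, d i : ℕ) * (1 / (2 * √t)) := by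
    unfold stepSize
    field_simp
  rw [hsplit]
  exact mul_le_of_le_one_left (by positivity) ((div_le_one hn).2 hdi)

theorem stepSize_mul_le_half (hn : 0 < ∑ i, d i) (hL : 0 < L) (ht : 1 ≤ t) (i : Fin N) :
    stepSize d L t * d i * L ≤ 1 / 2 := by
  have ht' : 1 ≤ √(t : ℝ) := Real.one_le_sqrt.2 (by exact_mod_cast ht)
  exact (stepSize_mul_le hn hL ht i).trans
    (one_div_le_one_div_of_le two_pos (le_mul_of_one_le_right two_pos.le ht'))

theorem stepSize_mul_self (d : Fin N → ℕ) (L : ℝ) (t : ℕ) :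
    stepSize d L t * t = √t / (2 * (∑ i, d i : ℕ) * L) := by
  rw [stepSize, one_div_mul_eq_div, div_mul_eq_div_div_swap, Real.div_sqrt]

theorem coeff_stepSize_pos (hn : 0 < ∑ i, d i) (hL : 0 < L) (hβ : 0 < β)
    (hlam : ∀ i, 0 < lam i) (ht : 1 ≤ t) (i : Fin N) : 0 < coeff lam β (stepSize d L) t i := by
  have := stepSize_pos hn hL ht
  have := hlam i
  unfold coeff
  positivity

theorem sum_one_div_coeff (lam : Fin N → ℝ) (β : ℝ) (η : ℕ → ℝ) (t : ℕ) :
    ∑ i, 1 / coeff lam β η t i = (∑ i, lam i) / (η t * β * (t + 1)) := by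
  simp only [coeff, one_div_div, Finset.sum_div]

theorem sum_mul_sq_stepSize_le (hn : 0 < ∑ i, d i) (hL : 0 < L) (hlam : ∀ i, 0 ≤ lam i)
    (ht : 1 ≤ t) :
    ∑ i, lam i * (2 * (stepSize d L t * d i * L) ^ 2) ≤ (∑ i, lam i) / 2 / t := by
  have hη := (stepSize_pos hn hL ht).le
  rw [Finset.sum_div, Finset.sum_div]
  refine Finset.sum_le_sum fun i _ => ?_
  calc lam i * (2 * (stepSize d L t * d i * L) ^ 2)
      ≤ lam i * (2 * (1 / (2 * √t)) ^ 2) := by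
        have := hlam i
        have := stepSize_mul_le hn hL ht i
        gcongr
    _ = lam i / 2 / t := by
        rw [div_pow, mul_pow, Real.sq_sqrt (Nat.cast_nonneg t)]
        ring

theorem stepSize_error_le (hn : 0 < ∑ i, d i) (hL : 0 < L) (hβ : 0 < β)
    (hlam : ∀ i, 0 ≤ lam i) {ε K : ℝ} (hε : 0 ≤ ε) (hK : 0 ≤ K) (ht : 1 ≤ t) :
    stepSize d L t * (ε + K * ∑ i, 1 / coeff lam β (stepSize d L) t i) +
        ∑ i, lam i * (2 * (stepSize d L t * d i * L) ^ 2) ≤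
      stepSize d L 1 * ε + (K * (∑ i, lam i) / β + (∑ i, lam i) / 2) / t := by
  have hΛ : 0 ≤ ∑ i, lam i := Finset.sum_nonneg fun i _ => hlam i
  have hη := stepSize_pos hn hL ht
  have : (0 : ℝ) < t := by exact_mod_cast ht
  have hcomparison : stepSize d L t * ε ≤ stepSize d L 1 * ε :=
    mul_le_mul_of_nonneg_right (stepSize_anti hn hL le_rfl ht) hε
  have hbias : stepSize d L t * (K * ∑ i, 1 / coeff lam β (stepSize d L) t i) ≤
      K * (∑ i, lam i) / β / t := by
    calc stepSize d L t * (K * ∑ i, 1 / coeff lam β (stepSize d L) t i)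
        = K * (∑ i, lam i) / β / (t + 1) := by
          rw [sum_one_div_coeff]
          field_simp
      _ ≤ K * (∑ i, lam i) / β / t := by
          gcongr
          linarith
  rw [mul_add, add_div]
  linarith [sum_mul_sq_stepSize_le hn hL hlam ht]

variable {G : SmoothConcaveGame N d} {R : (i : Fin N) → E (d i) → ℝ} {ν : Fin N → ℝ}
  {xstar : Profile d} {T : ℕ}

/-- The point at distance `1 / T` (relative to the whole segment) from the equilibrium `xstar`
on the segment from `xstar` to the first pivot: unlike `xstar` it is interior, so that its
Bregman divergences are defined, and these grow only logarithmically with the horizon `T`. -/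
def comparator (G : SmoothConcaveGame N d) (R : (i : Fin N) → E (d i) → ℝ) (xstar : Profile d)
    (T : ℕ) : Profile d := fun i =>
  argminOn (interior (G.X i)) (R i) +
    (1 - 1 / (T : ℝ)) • (xstar i - argminOn (interior (G.X i)) (R i))

theorem one_sub_one_div_mem_Ico (hT : 1 ≤ T) : 1 - 1 / (T : ℝ) ∈ Set.Ico (0 : ℝ) 1 := by
  have hT : (1 : ℝ) ≤ T := by exact_mod_cast hT
  exact ⟨sub_nonneg.2 ((div_le_one (by positivity)).2 hT), sub_lt_self _ (by positivity)⟩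

theorem comparator_mem_interiorActions (hR : ∀ i, IsSelfConcordantBarrier (G.X i) (ν i) (R i))
    (hint : ∀ i, (interior (G.X i)).Nonempty) (hx : xstar ∈ G.actions) (hT : 1 ≤ T) :
    comparator G R xstar T ∈ G.interiorActions :=
  SmoothConcaveGame.mem_interiorActions.2 fun i => by
    have hmem := (G.convex_X i).combo_interior_self_mem_interior
      ((hR i).argminOn_spec (G.compact_X i) (hint i)).1 (SmoothConcaveGame.mem_actions.1 hx i)
      (sub_pos.2 (one_sub_one_div_mem_Ico hT).2) (one_sub_one_div_mem_Ico hT).1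
      (sub_add_cancel _ _)
    convert hmem using 1
    unfold comparator
    module

theorem norm_comparator_sub_le (hR : ∀ i, IsSelfConcordantBarrier (G.X i) (ν i) (R i))
    (hint : ∀ i, (interior (G.X i)).Nonempty) (hx : xstar ∈ G.actions) (T : ℕ) (i : Fin N) :
    ‖comparator G R xstar T i - xstar i‖ ≤ G.diameter / T := by
  have hsub : comparator G R xstar T i - xstar i =
      (1 / (T : ℝ)) • (argminOn (interior (G.X i)) (R i) - xstar i) := by
    unfold comparator
    module
  have hmem := interior_subset ((hR i).argminOn_spec (G.compact_X i) (hint i)).1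
  rw [hsub, norm_smul, Real.norm_of_nonneg (by positivity), one_div_mul_eq_div]
  exact div_le_div_of_nonneg_right
    (G.norm_sub_le_diameter hmem (SmoothConcaveGame.mem_actions.1 hx i)) (Nat.cast_nonneg T)

theorem bregman_comparator_le (hR : ∀ i, IsSelfConcordantBarrier (G.X i) (ν i) (R i))
    (hint : ∀ i, (interior (G.X i)).Nonempty) (hx : xstar ∈ G.actions) (hT : 1 ≤ T) (i : Fin N) :
    bregman (R i) (comparator G R xstar T i) (argminOn (interior (G.X i)) (R i)) ≤
      (max (ν i) 0 + 1) * Real.log T := by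
  have hlog := (hR i).sub_le_neg_mul_log (G.convex_X i) (κ := max (ν i) 0 + 1) (by positivity)
    ((le_max_left _ _).trans (le_add_of_nonneg_right zero_le_one))
    ((hR i).argminOn_spec (G.compact_X i) (hint i)).1 (SmoothConcaveGame.mem_actions.1 hx i)
    (one_sub_one_div_mem_Ico hT)
  rw [sub_sub_cancel, one_div, Real.log_inv, neg_mul_neg, ← one_div] at hlog
  rw [bregman, (hR i).gradient_argminOn (G.compact_X i) (hint i), inner_zero_left, sub_zero]
  exact hlog

theorem potential_comparator_pivot_one_le
    (hR : ∀ i, IsSelfConcordantBarrier (G.X i) (ν i) (R i))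
    (hint : ∀ i, (interior (G.X i)).Nonempty) (hlam : ∀ i, 0 ≤ lam i) (hx : xstar ∈ G.actions)
    (hT : 1 ≤ T) {c : ℝ} (hc : 0 ≤ c) (β : ℝ) (η : ℕ → ℝ) (z : ℕ → Profile d) :
    potential R lam (comparator G R xstar T) c (pivot G R lam β η z 1) ≤
      (∑ i, lam i * (max (ν i) 0 + 1)) * Real.log T + c * (N * G.diameter ^ 2) := by
  refine add_le_add ?_ (mul_le_mul_of_nonneg_left (sqDist_le_mul_sq fun i => ?_) hc)
  · rw [Finset.sum_mul]
    refine Finset.sum_le_sum fun i _ => ?_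
    rw [mul_assoc]
    exact mul_le_mul_of_nonneg_left (bregman_comparator_le hR hint hx hT i) (hlam i)
  · have hpivot := SmoothConcaveGame.interiorActions_subset
      (pivot_one_mem_interiorActions (lam := lam) (β := β) (η := η) hR hint z)
    have hcomp := SmoothConcaveGame.interiorActions_subset
      (comparator_mem_interiorActions hR hint hx hT)
    exact G.norm_sub_le_diameter (SmoothConcaveGame.mem_actions.1 hpivot i)
      (SmoothConcaveGame.mem_actions.1 hcomp i)

theorem sqDist_comparator_le (hR : ∀ i, IsSelfConcordantBarrier (G.X i) (ν i) (R i))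
    (hint : ∀ i, (interior (G.X i)).Nonempty) (hx : xstar ∈ G.actions) (hT : 1 ≤ T) :
    sqDist (comparator G R xstar T) xstar ≤ N * G.diameter ^ 2 / √T := by
  have hT1 : (1 : ℝ) ≤ T := by exact_mod_cast hT
  calc sqDist (comparator G R xstar T) xstar ≤ N * (G.diameter / T) ^ 2 :=
        sqDist_le_mul_sq (norm_comparator_sub_le hR hint hx T)
    _ = N * G.diameter ^ 2 / (T : ℝ) ^ 2 := by ring
    _ ≤ N * G.diameter ^ 2 / √T := by
        gcongr
        exact (Real.sqrt_le_left (by positivity)).2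
          ((le_self_pow₀ hT1 two_ne_zero).trans (le_self_pow₀ (one_le_pow₀ hT1) two_ne_zero))

theorem sqDist_play_le (hn : 0 < ∑ i, d i) (hL : 0 < L) (hβ : 0 < β) (hlam : ∀ i, 0 < lam i)
    (hR : ∀ i, IsSelfConcordantBarrier (G.X i) (ν i) (R i)) (ht : 1 ≤ t) {x z : Profile d}
    (hx : x ∈ G.interiorActions) (hz : ∀ i, ‖z i‖ = 1) :
    sqDist (play R lam β (stepSize d L) t x z) x ≤
      2 * (∑ i, d i : ℕ) * L * (∑ i, lam i) / β / √t := by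
  have hc := coeff_stepSize_pos hn hL hβ hlam ht
  have hΛ : 0 ≤ ∑ i, lam i := Finset.sum_nonneg fun i _ => (hlam i).le
  have hη := stepSize_pos hn hL ht
  have : (0 : ℝ) < t := by exact_mod_cast ht
  calc sqDist (play R lam β (stepSize d L) t x z) x
      ≤ ∑ i, 1 / coeff lam β (stepSize d L) t i :=
        Finset.sum_le_sum fun i _ => norm_play_sub_sq_le hR hc hx hz i
    _ = (∑ i, lam i) / (stepSize d L t * β * (t + 1)) := sum_one_div_coeff _ _ _ _
    _ ≤ (∑ i, lam i) / (stepSize d L t * β * t) := by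
        gcongr
        linarith
    _ = 2 * (∑ i, d i : ℕ) * L * (∑ i, lam i) / β / √t := by
        rw [mul_right_comm, stepSize_mul_self]
        field_simp

theorem integral_potential_stepSize_succ_le {Ω : Type*} {mΩ : MeasurableSpace Ω} {P : Measure Ω}
    [IsProbabilityMeasure P] {z : ℕ → (i : Fin N) → Ω → Metric.sphere (0 : E (d i)) 1}
    (hz : IsUniformSampling P z) (hd : ∀ i, 1 ≤ d i) (hn : 0 < ∑ i, d i)
    (hR : ∀ i, IsSelfConcordantBarrier (G.X i) (ν i) (R i))
    (hint : ∀ i, (interior (G.X i)).Nonempty) (hmono : G.IsStronglyMonotone lam β)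
    (hL0 : 0 < L) (hL : ∀ i, ∀ x ∈ G.actions, |G.u i x| ≤ L) (ht : 1 ≤ t) {ℓ : NNReal}
    (hℓ : G.GradLipschitzWith ℓ) {p : Profile d} (hp : p ∈ G.actions) {ε : ℝ} (hε0 : 0 ≤ ε)
    (hε : ∀ x ∈ G.actions, ∑ i, lam i * inner ℝ (G.v i p) (x i - p i) ≤ ε) :
    ∫ ω, potential R lam p (stepSize d L (t + 1) * β * (t + 1 : ℕ) / 2)
        (randomPivot G R lam β (stepSize d L) z (t + 1) ω) ∂P ≤
      ∫ ω, potential R lam p (stepSize d L t * β * t / 2)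
          (randomPivot G R lam β (stepSize d L) z t ω) ∂P +
        (stepSize d L 1 * ε + ((∑ i, (lam i * ℓ) ^ 2) / (2 * β) * (∑ i, lam i) / β +
          (∑ i, lam i) / 2) / t) := by
  obtain ⟨hβ, hlam, -⟩ := id hmono
  have hc : ∀ s, 1 ≤ s → ∀ i, 0 < coeff lam β (stepSize d L) s i :=
    fun s hs => coeff_stepSize_pos hn hL0 hβ hlam hs
  have hK : 0 ≤ (∑ i, (lam i * ℓ) ^ 2) / (2 * β) :=
    div_nonneg (Finset.sum_nonneg fun i _ => sq_nonneg _) (by positivity)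
  have hcoeff : stepSize d L (t + 1) * β * (t + 1 : ℕ) / 2 ≤
      stepSize d L t * β * (t + 1) / 2 := by
    have := stepSize_anti hn hL0 ht (Nat.le_succ t)
    push_cast
    gcongr
  have hintegrable : ∀ c, Integrable (fun ω => potential R lam p c
      (randomPivot G R lam β (stepSize d L) z (t + 1) ω)) P := fun c =>
    hz.integrable_comp_randomPivot hR hint hc (by omega) (continuousOn_potential hR p c)
  refine (integral_mono (hintegrable _) (hintegrable _) fun ω =>
    potential_mono R lam hcoeff p _).trans ?_
  refine (hz.integral_potential_succ_le hd hR hint hmono hc hL ht (stepSize_pos hn hL0 ht).le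
    (stepSize_mul_le_half hn hL0 ht) hℓ hp hε).trans ?_
  refine add_le_add_right ?_ _
  exact stepSize_error_le hn hL0 hβ (fun i => (hlam i).le) hε0 hK ht

theorem exists_forall_sum_inner_v_comparator_le
    (hR : ∀ i, IsSelfConcordantBarrier (G.X i) (ν i) (R i))
    (hint : ∀ i, (interior (G.X i)).Nonempty) (hlam : ∀ i, 0 ≤ lam i) (hstar : G.IsNash xstar) :
    ∃ D, 0 ≤ D ∧ ∀ T, 1 ≤ T → ∀ x ∈ G.actions,
      ∑ i, lam i * inner ℝ (G.v i (comparator G R xstar T)) (x i - comparator G R xstar T i) ≤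
        D / T := by
  obtain ⟨ℓ, hℓ⟩ := G.exists_gradLipschitzWith
  have hdiam := G.diameter_nonneg
  refine ⟨∑ i, lam i * ((ℓ * √N * G.diameter + ‖G.v i xstar‖) * G.diameter),
    Finset.sum_nonneg fun i _ => mul_nonneg (hlam i) (by positivity), fun T hT x hx => ?_⟩
  rw [Finset.sum_div]
  refine Finset.sum_le_sum fun i _ => ?_
  rw [mul_div_assoc, mul_div_assoc]
  exact mul_le_mul_of_nonneg_left (hℓ.inner_v_le hstar
    (SmoothConcaveGame.interiorActions_subset
      (comparator_mem_interiorActions hR hint hstar.1 hT))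
    (norm_comparator_sub_le hR hint hstar.1 T) hx i) (hlam i)

theorem exists_integral_potential_le (hd : ∀ i, 1 ≤ d i) (hn : 0 < ∑ i, d i)
    (hR : ∀ i, IsSelfConcordantBarrier (G.X i) (ν i) (R i))
    (hint : ∀ i, (interior (G.X i)).Nonempty) (hmono : G.IsStronglyMonotone lam β)
    (hL0 : 0 < L) (hL : ∀ i, ∀ x ∈ G.actions, |G.u i x| ≤ L) (hstar : G.IsNash xstar) :
    ∃ C : ℝ, ∀ (Ω : Type*) [MeasurableSpace Ω] (P : Measure Ω) [IsProbabilityMeasure P]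
      (z : ℕ → (i : Fin N) → Ω → Metric.sphere (0 : E (d i)) 1), IsUniformSampling P z →
      ∀ T, 2 ≤ T → ∫ ω, potential R lam (comparator G R xstar T) (stepSize d L T * β * T / 2)
        (randomPivot G R lam β (stepSize d L) z T ω) ∂P ≤ C * Real.log T := by
  obtain ⟨hβ, hlam, -⟩ := id hmono
  obtain ⟨ℓ, hℓ⟩ := G.exists_gradLipschitzWith
  obtain ⟨D, hD, hcomp⟩ := exists_forall_sum_inner_v_comparator_le hR hint
    (fun i => (hlam i).le) hstar
  have hΛ : 0 ≤ ∑ i, lam i := Finset.sum_nonneg fun i _ => (hlam i).le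
  have : 0 ≤ ∑ i, (lam i * ℓ) ^ 2 := Finset.sum_nonneg fun i _ => sq_nonneg _
  have hη := (stepSize_pos (d := d) hn hL0 le_rfl).le
  have hη' : 0 ≤ stepSize d L 1 * β * (1 : ℕ) / 2 := by positivity
  set B := (∑ i, (lam i * ℓ) ^ 2) / (2 * β) * (∑ i, lam i) / β + (∑ i, lam i) / 2
  set W := ∑ i, lam i * (max (ν i) 0 + 1)
  set A := stepSize d L 1 * β * (1 : ℕ) / 2 * (N * G.diameter ^ 2) + stepSize d L 1 * D + B
    with hA
  have hB0 : 0 ≤ B := by positivity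
  have hA0 : 0 ≤ A := by positivity
  refine ⟨W + B + A / Real.log 2, fun Ω _ P _ z hz T hT => ?_⟩
  have hT1 : 1 ≤ T := by omega
  have hrec := le_add_log_of_succ_le
    (V := fun t => ∫ ω, potential R lam (comparator G R xstar T) (stepSize d L t * β * t / 2)
      (randomPivot G R lam β (stepSize d L) z t ω) ∂P) (A := stepSize d L 1 * (D / T))
    (by positivity) hB0 (fun t ht => integral_potential_stepSize_succ_le hz hd hn hR hint hmono
      hL0 hL ht hℓ (SmoothConcaveGame.interiorActions_subset
        (comparator_mem_interiorActions hR hint hstar.1 hT1)) (by positivity) (hcomp T hT1)) hT1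
  have hinit : ∫ ω, potential R lam (comparator G R xstar T) (stepSize d L 1 * β * (1 : ℕ) / 2)
      (randomPivot G R lam β (stepSize d L) z 1 ω) ∂P ≤
      W * Real.log T + stepSize d L 1 * β * (1 : ℕ) / 2 * (N * G.diameter ^ 2) := by
    simpa [randomPivot, pivot] using potential_comparator_pivot_one_le hR hint
      (fun i => (hlam i).le) hstar.1 hT1 hη' β (stepSize d L) 0
  have hcancel : (T : ℝ) * (stepSize d L 1 * (D / T)) = stepSize d L 1 * D := by
    field_simp
  have hlog := le_div_log_two_mul_log hA0 hT
  rw [hcancel] at hrec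
  linarith

/- At the horizon the squared distance has coefficient `η_T β T / 2`, of order `√T`. -/
theorem exists_integral_sqDist_comparator_le (hd : ∀ i, 1 ≤ d i) (hn : 0 < ∑ i, d i)
    (hR : ∀ i, IsSelfConcordantBarrier (G.X i) (ν i) (R i))
    (hint : ∀ i, (interior (G.X i)).Nonempty) (hmono : G.IsStronglyMonotone lam β)
    (hL0 : 0 < L) (hL : ∀ i, ∀ x ∈ G.actions, |G.u i x| ≤ L) (hstar : G.IsNash xstar) :
    ∃ C : ℝ, ∀ (Ω : Type*) [MeasurableSpace Ω] (P : Measure Ω) [IsProbabilityMeasure P]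
      (z : ℕ → (i : Fin N) → Ω → Metric.sphere (0 : E (d i)) 1), IsUniformSampling P z →
      ∀ T, 2 ≤ T → ∫ ω, sqDist (randomPivot G R lam β (stepSize d L) z T ω)
        (comparator G R xstar T) ∂P ≤ C * Real.log T / √T := by
  obtain ⟨hβ, hlam, -⟩ := id hmono
  obtain ⟨C, hC⟩ := exists_integral_potential_le hd hn hR hint hmono hL0 hL hstar
  have hc : ∀ t, 1 ≤ t → ∀ i, 0 < coeff lam β (stepSize d L) t i :=
    fun t ht => coeff_stepSize_pos hn hL0 hβ hlam ht
  refine ⟨4 * (∑ i, d i : ℕ) * L / β * C, fun Ω _ P _ z hz T hT => ?_⟩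
  have hT1 : 1 ≤ T := by omega
  have hcoeff : stepSize d L T * β * T / 2 = √T / (4 * (∑ i, d i : ℕ) * L / β) := by
    rw [mul_right_comm, stepSize_mul_self]
    field_simp
    norm_num
  have hle : √T / (4 * (∑ i, d i : ℕ) * L / β) * ∫ ω, sqDist
      (randomPivot G R lam β (stepSize d L) z T ω) (comparator G R xstar T) ∂P ≤
      C * Real.log T := by
    rw [← hcoeff, ← integral_const_mul]
    refine (integral_mono ((hz.integrable_comp_randomPivot hR hint hc hT1
      (continuous_sqDist_left _).continuousOn).const_mul _)
      (hz.integrable_comp_randomPivot hR hint hc hT1 (continuousOn_potential hR _ _))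
      fun ω => ?_).trans (hC Ω P z hz T hT)
    exact mul_sqDist_le_potential hR (fun i => (hlam i).le) _
      (comparator_mem_interiorActions hR hint hstar.1 hT1)
      (randomPivot_mem_interiorActions hR hint hc z hT1 ω)
  have hn' : (0 : ℝ) < (∑ i, d i : ℕ) := by exact_mod_cast hn
  rw [div_mul_eq_mul_div, div_le_iff₀ (by positivity)] at hle
  rw [le_div_iff₀ (Real.sqrt_pos.2 (by positivity))]
  linarith

theorem exists_integral_sqDist_play_le (hd : ∀ i, 1 ≤ d i) (hn : 0 < ∑ i, d i)
    (hR : ∀ i, IsSelfConcordantBarrier (G.X i) (ν i) (R i))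
    (hint : ∀ i, (interior (G.X i)).Nonempty) (hmono : G.IsStronglyMonotone lam β)
    (hL0 : 0 < L) (hL : ∀ i, ∀ x ∈ G.actions, |G.u i x| ≤ L) (hstar : G.IsNash xstar) :
    ∃ C : ℝ, ∀ (Ω : Type*) [MeasurableSpace Ω] (P : Measure Ω) [IsProbabilityMeasure P]
      (z : ℕ → (i : Fin N) → Ω → Metric.sphere (0 : E (d i)) 1), IsUniformSampling P z →
      ∀ T, 2 ≤ T →
        Integrable (fun ω => sqDist (play R lam β (stepSize d L) T
          (randomPivot G R lam β (stepSize d L) z T ω) (roundDirections z T ω).toProfile)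
          xstar) P ∧
        ∫ ω, sqDist (play R lam β (stepSize d L) T
          (randomPivot G R lam β (stepSize d L) z T ω) (roundDirections z T ω).toProfile)
          xstar ∂P ≤ C * Real.log T / √T := by
  obtain ⟨hβ, hlam, -⟩ := id hmono
  obtain ⟨C, hC⟩ := exists_integral_sqDist_comparator_le hd hn hR hint hmono hL0 hL hstar
  have hc : ∀ t, 1 ≤ t → ∀ i, 0 < coeff lam β (stepSize d L) t i :=
    fun t ht => coeff_stepSize_pos hn hL0 hβ hlam ht
  have hΛ : 0 ≤ ∑ i, lam i := Finset.sum_nonneg fun i _ => (hlam i).le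
  set K := 2 * (∑ i, d i : ℕ) * L * (∑ i, lam i) / β + N * G.diameter ^ 2 with hK
  have hK0 : 0 ≤ K := by positivity
  refine ⟨3 * (C + K / Real.log 2), fun Ω _ P _ z hz T hT => ?_⟩
  have hT1 : 1 ≤ T := by omega
  have hplay := hz.integrable_comp hR hint hc hT1
    (H := fun q => sqDist (play R lam β (stepSize d L) T q.1 q.2) xstar)
    ((continuous_sqDist_left xstar).comp_continuousOn (continuousOn_play hR (hc T hT1)))
  have hpivot := hz.integrable_comp_randomPivot hR hint hc hT1
    (continuous_sqDist_left (comparator G R xstar T)).continuousOn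
  refine ⟨hplay, ?_⟩
  calc ∫ ω, sqDist (play R lam β (stepSize d L) T
        (randomPivot G R lam β (stepSize d L) z T ω) (roundDirections z T ω).toProfile) xstar ∂P
      ≤ ∫ ω, 3 * (sqDist (randomPivot G R lam β (stepSize d L) z T ω)
          (comparator G R xstar T) + K / √T) ∂P := by
        refine integral_mono hplay ((hpivot.add (integrable_const _)).const_mul 3) fun ω => ?_
        refine (sqDist_le_three_mul _ (randomPivot G R lam β (stepSize d L) z T ω)
          (comparator G R xstar T) _).trans ?_
        have hfirst := sqDist_play_le hn hL0 hβ hlam hR hT1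
          (randomPivot_mem_interiorActions hR hint hc z hT1 ω)
          (roundDirections z T ω).norm_toProfile
        have hlast := sqDist_comparator_le hR hint hstar.1 hT1
        rw [hK, add_div]
        linarith
    _ = 3 * (∫ ω, sqDist (randomPivot G R lam β (stepSize d L) z T ω)
          (comparator G R xstar T) ∂P + K / √T) := by
        rw [integral_const_mul, integral_add hpivot (integrable_const _)]
        simp
    _ ≤ 3 * (C * Real.log T / √T + K / Real.log 2 * Real.log T / √T) := by
        have := hC Ω P z hz T hT
        have := le_div_log_two_mul_log hK0 hT
        gcongr
    _ = 3 * (C + K / Real.log 2) * Real.log T / √T := by ring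

end Rate

end BanditGame

end

theorem mainTheorem2 {N : ℕ} {d : Fin N → ℕ} (hd : ∀ i, 1 ≤ d i)
    (G : BanditGame.SmoothConcaveGame N d)
    (hint : ∀ i, (interior (G.X i)).Nonempty)
    (lam : Fin N → ℝ) (β : ℝ) (hmono : G.IsStronglyMonotone lam β)
    (L : ℝ) (hL : ∀ i, ∀ x ∈ G.actions, |G.u i x| ≤ L)
    (ν : Fin N → ℝ) (R : (i : Fin N) → BanditGame.E (d i) → ℝ)
    (hR : ∀ i, BanditGame.IsSelfConcordantBarrier (G.X i) (ν i) (R i))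
    (xstar : BanditGame.Profile d) (hstar : G.IsNash xstar) :
    (∀ y, G.IsNash y → y = xstar) ∧
    ∃ (C : ℝ) (k : ℕ), ∀ (Ω : Type*) [MeasurableSpace Ω] (P : MeasureTheory.Measure Ω)
      [MeasureTheory.IsProbabilityMeasure P]
      (z : ℕ → (i : Fin N) → Ω → Metric.sphere (0 : BanditGame.E (d i)) 1),
      (∀ t, 1 ≤ t → ∀ i, Measurable (z t i) ∧
        MeasureTheory.Measure.map (z t i) P = BanditGame.sphereUniform (d i)) →
      ProbabilityTheory.iIndepFun (fun (p : {t : ℕ // 1 ≤ t} × Fin N) => z p.1 p.2) P →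
      ∀ T : ℕ, 2 ≤ T →
        MeasureTheory.Integrable (fun ω => BanditGame.sqDist (BanditGame.played G R lam β
          (BanditGame.stepSize d L) (fun t i => (z t i ω : BanditGame.E (d i))) T) xstar) P ∧
        ∫ ω, BanditGame.sqDist (BanditGame.played G R lam β
          (BanditGame.stepSize d L) (fun t i => (z t i ω : BanditGame.E (d i))) T) xstar ∂P
          ≤ C * Real.log T ^ k / √T := by
  refine ⟨fun y hy => hstar.eq hmono hy, ?_⟩
  rcases isEmpty_or_nonempty (Fin N) with hN | ⟨⟨i₀⟩⟩
  · refine ⟨0, 0, fun Ω _ P _ z _ _ T _ => ?_⟩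
    simp [BanditGame.sqDist]
  · have hn : 0 < ∑ i, d i := Finset.sum_pos (fun i _ => hd i) ⟨i₀, Finset.mem_univ i₀⟩
    have hL0 : 0 < L := BanditGame.SmoothConcaveGame.payoff_bound_pos (hd i₀) hint hmono hL
    obtain ⟨C, hC⟩ := BanditGame.exists_integral_sqDist_play_le hd hn hR hint hmono hL0 hL hstar
    refine ⟨C, 1, fun Ω _ P _ z hz hind T hT => ?_⟩
    have hsampling : BanditGame.IsUniformSampling P z :=
      ⟨fun t ht i => (hz t ht i).1, fun t ht i => (hz t ht i).2, hind⟩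
    rw [pow_one]
    exact hC Ω P z hsampling T hT
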